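/- **Model.** Time is slotted, $t=0,1,2,\dots$, and two servers $S_1,S_2$ transmit status update packets to a monitor. The service time on $S_m$ ($m=1,2$) is discrete phase-type, $\mathrm{DPH}(\alpha^{(m)},B^{(m)})$ of order $N_m$: $\alpha^{(m)}$ is a probability vector, $B^{(m)}$ a substochastic matrix with all phases transient, and $b^{(m)}=(I-B^{(m)})\mathbf 1$. A packet starts service in a phase drawn from $\alpha^{(m)}$ when it is generated; in each later slot, independently of the other server, its phase moves from $i$ to $i'$ with probability $B^{(m)}_{ii'}$, or the packet is received, with probability $b^{(m)}_i$. Fix an integer $k\ge1$ (freezing) and a priority server. A new packet is generated in the first slot at least $k$ slots after the previous generation in which some server is idle; it is served by the idle server, or by the priority server if both are idle. If $g(t)$ is the generation instant of the freshest packet received by slot $t$, the age of information is $\Delta(t)=t-g(t)$. At $t=0$ the system is in an arbitrary random state whose packets were all generated at instants $\le0$. **The chain $W$.** Let $W_t$ record which servers are busy, the phases of the packets in service, and the clock $l\in\{0,\dots,k-1\}$ (slots since the last generation, stopped at $k-1$). Its states are $(1,0,0,l)$ (both idle), $(2,i,0,l)$ (only $S_1$ busy), $(3,0,j,l)$ (only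 $S_2$ busy), $(4,i,j,l)$ (both busy); it is a finite Markov chain. It is called ergodic if it has a single recurrent class and this class is aperiodic. **The chain $Y$.** The absorbing Markov chain $Y_h$, $h=0,1,\dots$, follows the system $h$ slots after the generation of a packet $P^*$. Its transient states record the phases of the packets in service, the clock $l$ (except in state 8), and the following status. $P^*$ states: (1), (2) $P^*$ on $S_1$ and an older, resp. newer, packet on $S_2$; (3), (4) $P^*$ on $S_2$ and a newer, resp. older, packet on $S_1$; (5), (6) $P^*$ on $S_1$, resp. $S_2$, and the other server idle. Non-$P^*$ states ($P^*$ has been received; a packet is up to date if it is newer than $P^*$ and obsolete if it is older): (7) both servers idle; (8) both packets up to date; (9), (10) only $S_1$, resp. only $S_2$, busy, with an obsolete packet; (11) the packet on $S_1$ up to date and that on $S_2$ obsolete; (12) the reverse; (13), (14) only $S_1$, resp. only $S_2$, busy, with an up-to-date packet. The transition probabilities are those given by the rules above. From a non-$P^*$ state, $Y$ is absorbed (successfully) when an up-to-date packet is received; from a $P^*$ state, it is absorbed (unsuccessfully) when a packet newer than $P^*$ is received no later than $P^*$. Let $A$ be the matrix of transition probabilities among the transient states, $\mathcal C$ the set of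 non-$P^*$ transient states, and $v$ the indicator column vector of $\mathcal C$. For a law $p$ of $W$, the initial vector $\sigma=\sigma(p)$ of $Y$ is obtained by normalizing to total mass one the weights $$q(1,i',j',0)=\sum_j B^{(2)}_{jj'}\alpha^{(1)}_{i'}p(3,0,j,k-1)+\sum_{i,j} b^{(1)}_iB^{(2)}_{jj'}\alpha^{(1)}_{i'}p(4,i,j,k-1),$$ $$q(4,i',j',0)=\sum_i B^{(1)}_{ii'}\alpha^{(2)}_{j'}p(2,i,0,k-1)+\sum_{i,j} b^{(2)}_jB^{(1)}_{ii'}\alpha^{(2)}_{j'}p(4,i,j,k-1),$$ and, with $c=p(1,0,0,k-1)+\sum_i b^{(1)}_ip(2,i,0,k-1)+\sum_j b^{(2)}_jp(3,0,j,k-1)+\sum_{i,j}b^{(1)}_ib^{(2)}_jp(4,i,j,k-1)$, the weights $q(5,i',0,0)=\alpha^{(1)}_{i'}c$ if $S_1$ has priority, or $q(6,0,j',0)=\alpha^{(2)}_{j'}c$ if $S_2$ has priority; all other weights are zero. **Theorem.** $I-A$ is invertible. The law of $W_t$ has a long-run (Cesàro) average $p$, and $p$ is a stationary law of $W$. If $W$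 is ergodic, then $W$ has a unique stationary law and the law of $W_t$ converges to it. The vector $\sigma=\sigma(p)$ is a probability vector, $\sigma A(I-A)^{-1}v>0$, and $$u_\Delta(h)=\frac{\sigma A^h v}{\sigma A(I-A)^{-1}v}$$ satisfies $\sum_{h\ge1}u_\Delta(h)=1$. It is the steady-state PMF of the age of information: for every $h\ge0$, $$\lim_{T\to\infty}\frac1T\sum_{t<T}\Pr(\Delta(t)=h)=u_\Delta(h),$$ and $\lim_{t\to\infty}\Pr(\Delta(t)=h)=u_\Delta(h)$ whenever the law of $W_t$ converges (in particular if $W$ is ergodic, or if $W_0$ has a stationary law). Moreover $u_\Delta(h)$ is proportional to $\Pr(Y_h\in\mathcal C)$: there is $\kappa>0$, not depending on $h$, with $u_\Delta(h)=\kappa\Pr(Y_h\in\mathcal C)$ for all $h\ge0$, where $Y$ has initial vector $\sigma$. -/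

import Mathlib

open Filter Topology MeasureTheory Matrix

noncomputable section

/-- The two servers. Used to record which of them has priority when both are idle. -/
inductive Server
  | S₁
  | S₂
deriving DecidableEq

/-- A discrete phase-type distribution of order `N`: the law of the absorption time of a Markov
chain on `N` transient phases and one absorbing state, with initial vector `α` on the phases and
substochastic matrix `B` of transition probabilities among the phases. The last field says that
the probability of not being absorbed by time `n` tends to `0` from every phase. -/
structure DPH (N : ℕ) where
  α : Fin N → ℝ
  B : Matrix (Fin N) (Fin N) ℝ
  α_nonneg : ∀ i, 0 ≤ α i
  α_sum : ∑ i, α i = 1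
  B_nonneg : ∀ i j, 0 ≤ B i j
  B_sum_le : ∀ i, ∑ j, B i j ≤ 1
  transient : ∀ i, Tendsto (fun n : ℕ => ((B ^ n) *ᵥ 1) i) atTop (𝓝 0)

/-- The vector `b = (I - B) 1` of one-step absorption probabilities. -/
def DPH.b {N : ℕ} (D : DPH N) : Fin N → ℝ := (1 - D.B) *ᵥ 1

/-! ### Markov chains on countable state spaces -/

/-- `Z` is a (possibly time-inhomogeneous) Markov chain with countable state space `S` and
one-step transition probabilities `K t z z'` from time `t` to time `t + 1`. -/
structure IsMarkovChain {Ω S : Type*} [MeasurableSpace Ω] (P : Measure Ω) (Z : ℕ → Ω → S)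
    (K : ℕ → S → S → ℝ) : Prop where
  measurableSet_preimage : ∀ t z, MeasurableSet (Z t ⁻¹' {z})
  path_prob : ∀ (n : ℕ) (z : ℕ → S),
    P.real {ω | ∀ t ≤ n, Z t ω = z t} =
      P.real {ω | Z 0 ω = z 0} * ∏ t ∈ Finset.range n, K t (z t) (z (t + 1))

/-- `p` is a stationary distribution of the stochastic matrix `R`. -/
structure IsStationaryLaw {S : Type*} [Fintype S] (R : Matrix S S ℝ) (p : S → ℝ) : Prop where
  nonneg : ∀ s, 0 ≤ p s
  sum_eq_one : ∑ s, p s = 1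
  stationary : p ᵥ* R = p

/-! ### The dual-queue system and its age of information -/

/-- State of the system at a slot. The content of a server is `none` if it is idle and
`some (i, g)` if it transmits a packet generated at instant `g` whose service is in phase `i`.
`clock` is the number of slots since the last generation, stopped at `k - 1`, and `fresh` is the
generation instant of the freshest packet received so far. -/
@[ext] structure SysState (N₁ N₂ k : ℕ) where
  srv₁ : Option (Fin N₁ × ℤ)
  srv₂ : Option (Fin N₂ × ℤ)
  clock : Fin k
  fresh : ℤ
deriving DecidableEq

/-- Probability that the service phase of the current content becomes `o` one slot later, where
`none` means that no packet is in service any more. -/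
def serveProb {N : ℕ} (D : DPH N) : Option (Fin N × ℤ) → Option (Fin N) → ℝ
  | none, none => 1
  | none, some _ => 0
  | some (i, _), none => D.b i
  | some (i, _), some i' => D.B i i'

/-- The content of a server after a slot of service with outcome `o`. -/
def afterService {N : ℕ} : Option (Fin N × ℤ) → Option (Fin N) → Option (Fin N × ℤ)
  | some (_, g), some i' => some (i', g)
  | _, _ => none

/-- Update of the generation instant of the freshest received packet: a packet whose service is
completed is received; it is discarded as obsolete if a fresher one was received. -/
def freshAfter {N : ℕ} (f : ℤ) : Option (Fin N × ℤ) → Option (Fin N) → ℤ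
  | some (_, g), none => max f g
  | _, _ => f

/-- The state at slot `t + 1`, given the state `z` at slot `t`, the service outcomes `o₁`, `o₂`,
and the phases `e₁`, `e₂` in which a new packet would start its service. As long as the freezing
time of `k` slots has not elapsed nothing is generated; afterwards a new packet is generated as
soon as a server is idle, and goes to the server with priority if both are idle. -/
def sysStep {N₁ N₂ k : ℕ} (pr : Server) (t : ℕ) (z : SysState N₁ N₂ k)
    (o₁ : Option (Fin N₁)) (o₂ : Option (Fin N₂)) (e₁ : Fin N₁) (e₂ : Fin N₂) :
    SysState N₁ N₂ k :=
  let c₁ := afterService z.srv₁ o₁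
  let c₂ := afterService z.srv₂ o₂
  let f := freshAfter (freshAfter z.fresh z.srv₁ o₁) z.srv₂ o₂
  let zero : Fin k := ⟨0, z.clock.pos⟩
  let new₁ : Option (Fin N₁ × ℤ) := some (e₁, (t : ℤ) + 1)
  let new₂ : Option (Fin N₂ × ℤ) := some (e₂, (t : ℤ) + 1)
  if h : (z.clock : ℕ) + 1 < k then ⟨c₁, c₂, ⟨(z.clock : ℕ) + 1, h⟩, f⟩
  else
    match c₁, c₂ with
    | some x, some y => ⟨some x, some y, z.clock, f⟩
    | none, some y => ⟨new₁, some y, zero, f⟩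
    | some x, none => ⟨some x, new₂, zero, f⟩
    | none, none =>
      match pr with
      | .S₁ => ⟨new₁, none, zero, f⟩
      | .S₂ => ⟨none, new₂, zero, f⟩

/-- Transition probabilities of the system from slot `t` to slot `t + 1`: the two service outcomes
and the starting phases of new packets are independent. -/
def sysTrans {N₁ N₂ k : ℕ} (pr : Server) (D₁ : DPH N₁) (D₂ : DPH N₂) (t : ℕ)
    (z z' : SysState N₁ N₂ k) : ℝ :=
  ∑ o₁ : Option (Fin N₁), ∑ o₂ : Option (Fin N₂), ∑ e₁ : Fin N₁, ∑ e₂ : Fin N₂,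
    if sysStep pr t z o₁ o₂ e₁ e₂ = z' then
      serveProb D₁ z.srv₁ o₁ * serveProb D₂ z.srv₂ o₂ * D₁.α e₁ * D₂.α e₂
    else 0

/-- `Z` is the dual-queue system, observed from slot `0` on, started in an arbitrary (random)
state in which all packets present or received were generated at instants `≤ 0`. -/
structure IsDualQueue {N₁ N₂ k : ℕ} (pr : Server) (D₁ : DPH N₁) (D₂ : DPH N₂)
    {Ω : Type*} [MeasurableSpace Ω] (P : Measure Ω) (Z : ℕ → Ω → SysState N₁ N₂ k) : Prop where
  markov : IsMarkovChain P Z (sysTrans pr D₁ D₂)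
  init : ∀ᵐ ω ∂P, (Z 0 ω).fresh ≤ 0 ∧ (∀ x ∈ (Z 0 ω).srv₁, x.2 ≤ 0) ∧
    (∀ x ∈ (Z 0 ω).srv₂, x.2 ≤ 0)

/-- The age of information at slot `t`: the time since the generation of the freshest packet
received so far. -/
def aoi {N₁ N₂ k : ℕ} {Ω : Type*} (Z : ℕ → Ω → SysState N₁ N₂ k) (t : ℕ) (ω : Ω) : ℤ :=
  (t : ℤ) - (Z t ω).fresh

/-! ### The freezing clock -/

/-- Indicator of `l < k - 1` and `l' = l + 1`. -/
def tick {k : ℕ} (l l' : Fin k) : ℝ := if (l' : ℕ) = l + 1 then 1 else 0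

/-- Indicator of `l = k - 1`. -/
def last {k : ℕ} (l : Fin k) : ℝ := if (l : ℕ) + 1 = k then 1 else 0

/-- Indicator of `l = k - 1` and `l' = 0`. -/
def wrap {k : ℕ} (l l' : Fin k) : ℝ := if (l' : ℕ) = 0 then last l else 0

/-- Indicator of `l < k - 1` and `l' = l + 1`, or `l = l' = k - 1`. -/
def tickOrHold {k : ℕ} (l l' : Fin k) : ℝ := if l' = l then last l else tick l l'

/-- Indicator of `S₁` priority. -/
def prio₁ (pr : Server) : ℝ := if pr = .S₁ then 1 else 0

/-- Indicator of `S₂` priority. -/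
def prio₂ (pr : Server) : ℝ := if pr = .S₂ then 1 else 0

/-! ### The recurrent Markov chain `W` of the servers -/

/-- States of `W`: `c1` both idle, `c2` only `S₁` busy, `c3` only `S₂` busy, `c4` both busy. -/
inductive WState (N₁ N₂ k : ℕ)
  | c1 (l : Fin k)
  | c2 (i : Fin N₁) (l : Fin k)
  | c3 (j : Fin N₂) (l : Fin k)
  | c4 (i : Fin N₁) (j : Fin N₂) (l : Fin k)
deriving DecidableEq, Fintype

/-- The state of `W` in a given state of the system. -/
def SysState.toW {N₁ N₂ k : ℕ} (z : SysState N₁ N₂ k) : WState N₁ N₂ k :=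
  match z.srv₁, z.srv₂ with
  | none, none => .c1 z.clock
  | some x, none => .c2 x.1 z.clock
  | none, some y => .c3 y.1 z.clock
  | some x, some y => .c4 x.1 y.1 z.clock

/-- Transition probabilities of `W`. -/
def rmcTrans {N₁ N₂ k : ℕ} (pr : Server) (D₁ : DPH N₁) (D₂ : DPH N₂) :
    WState N₁ N₂ k → WState N₁ N₂ k → ℝ
  | .c1 l, .c1 l' => tick l l'
  | .c1 l, .c2 i' l' => wrap l l' * prio₁ pr * D₁.α i'
  | .c1 l, .c3 j' l' => wrap l l' * prio₂ pr * D₂.α j'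
  | .c1 _, .c4 _ _ _ => 0
  | .c2 i l, .c1 l' => tick l l' * D₁.b i
  | .c2 i l, .c2 i' l' => tick l l' * D₁.B i i' + wrap l l' * prio₁ pr * D₁.b i * D₁.α i'
  | .c2 i l, .c3 j' l' => wrap l l' * prio₂ pr * D₁.b i * D₂.α j'
  | .c2 i l, .c4 i' j' l' => wrap l l' * D₁.B i i' * D₂.α j'
  | .c3 j l, .c1 l' => tick l l' * D₂.b j
  | .c3 j l, .c2 i' l' => wrap l l' * prio₁ pr * D₂.b j * D₁.α i'
  | .c3 j l, .c3 j' l' => tick l l' * D₂.B j j' + wrap l l' * prio₂ pr * D₂.b j * D₂.α j'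
  | .c3 j l, .c4 i' j' l' => wrap l l' * D₂.B j j' * D₁.α i'
  | .c4 i j l, .c1 l' => tick l l' * D₁.b i * D₂.b j
  | .c4 i j l, .c2 i' l' =>
      tick l l' * D₂.b j * D₁.B i i' + wrap l l' * prio₁ pr * D₁.b i * D₂.b j * D₁.α i'
  | .c4 i j l, .c3 j' l' =>
      tick l l' * D₁.b i * D₂.B j j' + wrap l l' * prio₂ pr * D₁.b i * D₂.b j * D₂.α j'
  | .c4 i j l, .c4 i' j' l' =>
      tickOrHold l l' * D₁.B i i' * D₂.B j j' + wrap l l' * D₁.b i * D₂.B j j' * D₁.α i'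
        + wrap l l' * D₂.b j * D₁.B i i' * D₂.α j'

/-- The transition matrix of `W`. -/
def rmcMatrix {N₁ N₂ k : ℕ} (pr : Server) (D₁ : DPH N₁) (D₂ : DPH N₂) :
    Matrix (WState N₁ N₂ k) (WState N₁ N₂ k) ℝ := Matrix.of (rmcTrans pr D₁ D₂)

/-- The chain `W` has a single recurrent class, and this class is aperiodic: some state can be
visited at all sufficiently late times, whatever the initial state. -/
def RmcErgodic {N₁ N₂ : ℕ} (k : ℕ) (pr : Server) (D₁ : DPH N₁) (D₂ : DPH N₂) : Prop :=
  ∃ w₀ : WState N₁ N₂ k, ∀ w, ∀ᶠ n in atTop, 0 < (rmcMatrix pr D₁ D₂ ^ n) w w₀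

/-! ### The absorbing Markov chain `Y` following a packet `P*` -/

/-- Transient states of `Y`. In `c1`, …, `c6` the packet `P*` is in the system; `τ₁`, `τ₂` are the
generation instants of the packets on `S₁`, `S₂`. In `c7`, …, `c14` it has been received; `P₁`,
`P₂` are the packets on `S₁`, `S₂`.
`c1`: `P*` on `S₁`, `τ₁ > τ₂`. `c2`: `P*` on `S₁`, `τ₁ < τ₂`.
`c3`: `P*` on `S₂`, `τ₁ > τ₂`. `c4`: `P*` on `S₂`, `τ₁ < τ₂`.
`c5`: `P*` on `S₁`, `S₂` idle. `c6`: `P*` on `S₂`, `S₁` idle. `c7`: both idle.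
`c8`: `P₁`, `P₂` up to date.
`c9`: `P₁` obsolete, `S₂` idle. `c10`: `P₂` obsolete, `S₁` idle.
`c11`: `P₁` up to date, `P₂` obsolete. `c12`: `P₂` up to date, `P₁` obsolete.
`c13`: `P₁` up to date, `S₂` idle. `c14`: `P₂` up to date, `S₁` idle. -/
inductive YState (N₁ N₂ k : ℕ)
  | c1 (i : Fin N₁) (j : Fin N₂) (l : Fin k)
  | c2 (i : Fin N₁) (j : Fin N₂) (l : Fin k)
  | c3 (i : Fin N₁) (j : Fin N₂) (l : Fin k)
  | c4 (i : Fin N₁) (j : Fin N₂) (l : Fin k)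
  | c5 (i : Fin N₁) (l : Fin k)
  | c6 (j : Fin N₂) (l : Fin k)
  | c7 (l : Fin k)
  | c8 (i : Fin N₁) (j : Fin N₂)
  | c9 (i : Fin N₁) (l : Fin k)
  | c10 (j : Fin N₂) (l : Fin k)
  | c11 (i : Fin N₁) (j : Fin N₂) (l : Fin k)
  | c12 (i : Fin N₁) (j : Fin N₂) (l : Fin k)
  | c13 (i : Fin N₁) (l : Fin k)
  | c14 (j : Fin N₂) (l : Fin k)
deriving DecidableEq, Fintype

/-- The two absorbing states of `Y`: `succ` is entered when the first packet fresher than `P*` is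
received after `P*`, and `unsucc` when such a packet is received no later than `P*`. -/
inductive YAbs
  | succ
  | unsucc
deriving DecidableEq

instance : Fintype YAbs := ⟨{.succ, .unsucc}, by intro x; cases x <;> simp⟩

/-- Transition probabilities of `Y` among the transient states. -/
def amcTrans {N₁ N₂ k : ℕ} (pr : Server) (D₁ : DPH N₁) (D₂ : DPH N₂) :
    YState N₁ N₂ k → YState N₁ N₂ k → ℝ
  | .c1 i j l, .c10 j' l' => tick l l' * D₁.b i * D₂.B j j'
  | .c1 i j l, .c11 i' j' l' => wrap l l' * D₁.b i * D₂.B j j' * D₁.α i'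
  | .c1 i j l, .c7 l' => tick l l' * D₁.b i * D₂.b j
  | .c1 i j l, .c13 i' l' => wrap l l' * prio₁ pr * D₁.b i * D₂.b j * D₁.α i'
  | .c1 i j l, .c14 j' l' => wrap l l' * prio₂ pr * D₁.b i * D₂.b j * D₂.α j'
  | .c1 i j l, .c5 i' l' => tick l l' * D₂.b j * D₁.B i i'
  | .c1 i j l, .c2 i' j' l' => wrap l l' * D₂.b j * D₁.B i i' * D₂.α j'
  | .c1 i j l, .c1 i' j' l' => tickOrHold l l' * D₁.B i i' * D₂.B j j'
  | .c2 i j l, .c14 j' l' => tick l l' * D₁.b i * D₂.B j j'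
  | .c2 i j l, .c8 i' j' => last l * D₁.b i * D₂.B j j' * D₁.α i'
  | .c2 i j l, .c2 i' j' l' => tickOrHold l l' * D₁.B i i' * D₂.B j j'
  | .c3 i j l, .c13 i' l' => tick l l' * D₂.b j * D₁.B i i'
  | .c3 i j l, .c8 i' j' => last l * D₂.b j * D₁.B i i' * D₂.α j'
  | .c3 i j l, .c3 i' j' l' => tickOrHold l l' * D₁.B i i' * D₂.B j j'
  | .c4 i j l, .c6 j' l' => tick l l' * D₁.b i * D₂.B j j'
  | .c4 i j l, .c3 i' j' l' => wrap l l' * D₁.b i * D₂.B j j' * D₁.α i'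
  | .c4 i j l, .c7 l' => tick l l' * D₁.b i * D₂.b j
  | .c4 i j l, .c13 i' l' => wrap l l' * prio₁ pr * D₁.b i * D₂.b j * D₁.α i'
  | .c4 i j l, .c14 j' l' => wrap l l' * prio₂ pr * D₁.b i * D₂.b j * D₂.α j'
  | .c4 i j l, .c9 i' l' => tick l l' * D₂.b j * D₁.B i i'
  | .c4 i j l, .c12 i' j' l' => wrap l l' * D₂.b j * D₁.B i i' * D₂.α j'
  | .c4 i j l, .c4 i' j' l' => tickOrHold l l' * D₁.B i i' * D₂.B j j'
  | .c5 i l, .c7 l' => tick l l' * D₁.b i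
  | .c5 i l, .c13 i' l' => wrap l l' * prio₁ pr * D₁.b i * D₁.α i'
  | .c5 i l, .c14 j' l' => wrap l l' * prio₂ pr * D₁.b i * D₂.α j'
  | .c5 i l, .c5 i' l' => tick l l' * D₁.B i i'
  | .c5 i l, .c2 i' j' l' => wrap l l' * D₁.B i i' * D₂.α j'
  | .c6 j l, .c7 l' => tick l l' * D₂.b j
  | .c6 j l, .c13 i' l' => wrap l l' * prio₁ pr * D₂.b j * D₁.α i'
  | .c6 j l, .c14 j' l' => wrap l l' * prio₂ pr * D₂.b j * D₂.α j'
  | .c6 j l, .c6 j' l' => tick l l' * D₂.B j j'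
  | .c6 j l, .c3 i' j' l' => wrap l l' * D₂.B j j' * D₁.α i'
  | .c7 l, .c7 l' => tick l l'
  | .c7 l, .c13 i' l' => wrap l l' * prio₁ pr * D₁.α i'
  | .c7 l, .c14 j' l' => wrap l l' * prio₂ pr * D₂.α j'
  | .c8 i j, .c8 i' j' => D₁.B i i' * D₂.B j j'
  | .c9 i l, .c7 l' => tick l l' * D₁.b i
  | .c9 i l, .c13 i' l' => wrap l l' * prio₁ pr * D₁.b i * D₁.α i'
  | .c9 i l, .c14 j' l' => wrap l l' * prio₂ pr * D₁.b i * D₂.α j'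
  | .c9 i l, .c9 i' l' => tick l l' * D₁.B i i'
  | .c9 i l, .c12 i' j' l' => wrap l l' * D₁.B i i' * D₂.α j'
  | .c10 j l, .c7 l' => tick l l' * D₂.b j
  | .c10 j l, .c13 i' l' => wrap l l' * prio₁ pr * D₂.b j * D₁.α i'
  | .c10 j l, .c14 j' l' => wrap l l' * prio₂ pr * D₂.b j * D₂.α j'
  | .c10 j l, .c10 j' l' => tick l l' * D₂.B j j'
  | .c10 j l, .c11 i' j' l' => wrap l l' * D₂.B j j' * D₁.α i'
  | .c11 i j l, .c13 i' l' => tick l l' * D₂.b j * D₁.B i i'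
  | .c11 i j l, .c8 i' j' => last l * D₂.b j * D₁.B i i' * D₂.α j'
  | .c11 i j l, .c11 i' j' l' => tickOrHold l l' * D₁.B i i' * D₂.B j j'
  | .c12 i j l, .c14 j' l' => tick l l' * D₁.b i * D₂.B j j'
  | .c12 i j l, .c8 i' j' => last l * D₁.b i * D₂.B j j' * D₁.α i'
  | .c12 i j l, .c12 i' j' l' => tickOrHold l l' * D₁.B i i' * D₂.B j j'
  | .c13 i l, .c13 i' l' => tick l l' * D₁.B i i'
  | .c13 i l, .c8 i' j' => last l * D₁.B i i' * D₂.α j'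
  | .c14 j l, .c14 j' l' => tick l l' * D₂.B j j'
  | .c14 j l, .c8 i' j' => last l * D₂.B j j' * D₁.α i'
  | _, _ => 0

/-- Transition probabilities of `Y` from the transient to the absorbing states. -/
def amcAbsorb {N₁ N₂ k : ℕ} (D₁ : DPH N₁) (D₂ : DPH N₂) : YState N₁ N₂ k → YAbs → ℝ
  | .c2 _ j _, .unsucc => D₂.b j
  | .c3 i _ _, .unsucc => D₁.b i
  | .c8 i j, .succ => D₁.b i + D₂.b j - D₁.b i * D₂.b j
  | .c11 i _ _, .succ => D₁.b i
  | .c12 _ j _, .succ => D₂.b j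
  | .c13 i _, .succ => D₁.b i
  | .c14 j _, .succ => D₂.b j
  | _, _ => 0

/-- The transient block `A` of the transition matrix of `Y`. -/
def amcA {N₁ N₂ : ℕ} (k : ℕ) (pr : Server) (D₁ : DPH N₁) (D₂ : DPH N₂) :
    Matrix (YState N₁ N₂ k) (YState N₁ N₂ k) ℝ := Matrix.of (amcTrans pr D₁ D₂)

/-- The transition matrix `Q` of `Y`. -/
def amcQ {N₁ N₂ : ℕ} (k : ℕ) (pr : Server) (D₁ : DPH N₁) (D₂ : DPH N₂) :
    Matrix (YState N₁ N₂ k ⊕ YAbs) (YState N₁ N₂ k ⊕ YAbs) ℝ :=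
  Matrix.fromBlocks (amcA k pr D₁ D₂) (Matrix.of (amcAbsorb D₁ D₂)) 0 1

/-- The set `𝒞` of the non-`P*` transient states. -/
def nonPStar (N₁ N₂ k : ℕ) : Set (YState N₁ N₂ k) :=
  {s | match s with
    | .c1 .. | .c2 .. | .c3 .. | .c4 .. | .c5 .. | .c6 .. => False
    | _ => True}

open scoped Classical in
/-- The indicator vector `v` of `𝒞`. -/
def amcV (N₁ N₂ k : ℕ) : YState N₁ N₂ k → ℝ := fun s => if s ∈ nonPStar N₁ N₂ k then 1 else 0

/-- If the law of `W` is `p`, the probability that in the next slot a packet `P*` is generated and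
`Y` starts in the given state. -/
def startWeight {N₁ N₂ k : ℕ} (pr : Server) (D₁ : DPH N₁) (D₂ : DPH N₂)
    (p : WState N₁ N₂ k → ℝ) : YState N₁ N₂ k → ℝ
  | .c1 i' j' l' => ∑ l, wrap l l' *
      (∑ j, D₂.B j j' * D₁.α i' * p (.c3 j l) +
        ∑ i, ∑ j, D₁.b i * D₂.B j j' * D₁.α i' * p (.c4 i j l))
  | .c4 i' j' l' => ∑ l, wrap l l' *
      (∑ i, D₁.B i i' * D₂.α j' * p (.c2 i l) +
        ∑ i, ∑ j, D₂.b j * D₁.B i i' * D₂.α j' * p (.c4 i j l))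
  | .c5 i' l' => prio₁ pr * ∑ l, wrap l l' *
      (D₁.α i' * p (.c1 l) + ∑ i, D₁.b i * D₁.α i' * p (.c2 i l) +
        ∑ j, D₂.b j * D₁.α i' * p (.c3 j l) +
        ∑ i, ∑ j, D₁.b i * D₂.b j * D₁.α i' * p (.c4 i j l))
  | .c6 j' l' => prio₂ pr * ∑ l, wrap l l' *
      (D₂.α j' * p (.c1 l) + ∑ i, D₁.b i * D₂.α j' * p (.c2 i l) +
        ∑ j, D₂.b j * D₂.α j' * p (.c3 j l) +
        ∑ i, ∑ j, D₁.b i * D₂.b j * D₂.α j' * p (.c4 i j l))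
  | _ => 0

/-- The initial probability vector `σ` of `Y`. -/
def amcSigma {N₁ N₂ k : ℕ} (pr : Server) (D₁ : DPH N₁) (D₂ : DPH N₂)
    (p : WState N₁ N₂ k → ℝ) : YState N₁ N₂ k → ℝ :=
  fun s => startWeight pr D₁ D₂ p s / ∑ s', startWeight pr D₁ D₂ p s'

/-- `Y` is the absorbing Markov chain with initial vector `σ` and transition matrix `Q`. -/
structure IsAMC {N₁ N₂ k : ℕ} (pr : Server) (D₁ : DPH N₁) (D₂ : DPH N₂)
    (p : WState N₁ N₂ k → ℝ) {Ω : Type*} [MeasurableSpace Ω] (P : Measure Ω)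
    (Y : ℕ → Ω → YState N₁ N₂ k ⊕ YAbs) : Prop where
  markov : IsMarkovChain P Y (fun _ => amcQ k pr D₁ D₂)
  init : ∀ s, P.real {ω | Y 0 ω = Sum.inl s} = amcSigma pr D₁ D₂ p s

/-- The normalizing constant `σ A (I - A)⁻¹ v`. -/
def aoiNorm {N₁ N₂ k : ℕ} (pr : Server) (D₁ : DPH N₁) (D₂ : DPH N₂)
    (p : WState N₁ N₂ k → ℝ) : ℝ :=
  amcSigma pr D₁ D₂ p ᵥ* (amcA k pr D₁ D₂ * (1 - amcA k pr D₁ D₂)⁻¹) ⬝ᵥ amcV N₁ N₂ k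

/-- The expression `σ A ^ h v / (σ A (I - A)⁻¹ v)`. -/
def aoiPMF {N₁ N₂ k : ℕ} (pr : Server) (D₁ : DPH N₁) (D₂ : DPH N₂)
    (p : WState N₁ N₂ k → ℝ) (h : ℕ) : ℝ :=
  amcSigma pr D₁ D₂ p ᵥ* (amcA k pr D₁ D₂ ^ h) ⬝ᵥ amcV N₁ N₂ k / aoiNorm pr D₁ D₂ p

/-- `a t` has long-run average `c`. -/
def HasLongRunAverage (a : ℕ → ℝ) (c : ℝ) : Prop :=
  Tendsto (fun T : ℕ => (∑ t ∈ Finset.range T, a t) / T) atTop (𝓝 c)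

end

/-! The age equals `h` at slot `t + 1 + h` exactly when the freshest received packet was generated
at `t + 1`. So fix the instant `g = t + 1`, call the packet generated then `P*`, and project each
later system state to the state of `Y` relative to `g` (`trackClass`). The projection is a lumping:
for a function `u` on the states of `Y`, the conditional expectation of `u ∘ trackClass g` one slot
later is `(A u) ∘ trackClass g` (`stepExp_trackClass`). The vector `v` pulls back to the indicator
of `fresh = g`, and the slot of generation contributes `startWeight`, which is linear in the law of
`W_t`. Iterating gives, for every `t` and not only in the limit, `Pr(Δ(t+1+h) = h) = q(law of W_t)
A^h v` with `q = startWeight` (`IsDualQueue.prob_fresh_eq`).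

By linearity, any long-run average or limit `p` of the law of `W_t` carries over to the age, with
value `q(p) A^h v`. Averages exist by the finite-dimensional mean ergodic theorem, because `W` is a
finite chain; under ergodicity Doeblin's contraction gives convergence. No renewal argument is
needed.

It remains to see that no mass escapes to infinite age. A second lumping, `staleClass`, treats all
packets generated by `t` as obsolete and again evolves by `A`, so `Pr(fresh(t+n) ≤ t)` is at most
the sum of the entries of `A^n 1`, uniformly in `t`. This tends to `0` because `A` is transient: `0
≤ x ≤ A x` forces `x = 0` (`amcA_eq_zero_of_le_mulVec`), which also makes `I - A` invertible with a
convergent Neumann series.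

Hence `∑ q A^h v = 1` over `h ≥ 0`. Its term at `h = 0` vanishes since `Y` starts in a `P*` state,
so `q A (I - A)⁻¹ v = 1`. In particular `q ≠ 0`; if `Λ` is its mass, then `σ = q / Λ`, the
normalizing constant is `1 / Λ`, and `u_Δ(h) = q A^h v`. -/

/-! ### Sums over the states of `Y` and `W` -/

/-- The states of `Y` as a sum type. -/
def YState.equivSum (N₁ N₂ k : ℕ) : YState N₁ N₂ k ≃
    (Fin N₁ × Fin N₂ × Fin k) ⊕ (Fin N₁ × Fin N₂ × Fin k) ⊕ (Fin N₁ × Fin N₂ × Fin k) ⊕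
    (Fin N₁ × Fin N₂ × Fin k) ⊕ (Fin N₁ × Fin k) ⊕ (Fin N₂ × Fin k) ⊕ Fin k ⊕
    (Fin N₁ × Fin N₂) ⊕ (Fin N₁ × Fin k) ⊕ (Fin N₂ × Fin k) ⊕ (Fin N₁ × Fin N₂ × Fin k) ⊕
    (Fin N₁ × Fin N₂ × Fin k) ⊕ (Fin N₁ × Fin k) ⊕ (Fin N₂ × Fin k) where
  toFun
    | .c1 i j l => .inl (i, j, l)
    | .c2 i j l => .inr (.inl (i, j, l))
    | .c3 i j l => .inr (.inr (.inl (i, j, l)))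
    | .c4 i j l => .inr (.inr (.inr (.inl (i, j, l))))
    | .c5 i l => .inr (.inr (.inr (.inr (.inl (i, l)))))
    | .c6 j l => .inr (.inr (.inr (.inr (.inr (.inl (j, l))))))
    | .c7 l => .inr (.inr (.inr (.inr (.inr (.inr (.inl l))))))
    | .c8 i j => .inr (.inr (.inr (.inr (.inr (.inr (.inr (.inl (i, j))))))))
    | .c9 i l => .inr (.inr (.inr (.inr (.inr (.inr (.inr (.inr (.inl (i, l)))))))))
    | .c10 j l => .inr (.inr (.inr (.inr (.inr (.inr (.inr (.inr (.inr (.inl (j, l))))))))))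
    | .c11 i j l =>
        .inr (.inr (.inr (.inr (.inr (.inr (.inr (.inr (.inr (.inr (.inl (i, j, l)))))))))))
    | .c12 i j l =>
        .inr (.inr (.inr (.inr (.inr (.inr (.inr (.inr (.inr (.inr (.inr (.inl (i, j, l))))))))))))
    | .c13 i l =>
        .inr (.inr (.inr (.inr (.inr (.inr (.inr (.inr (.inr (.inr (.inr (.inr
          (.inl (i, l)))))))))))))
    | .c14 j l =>
        .inr (.inr (.inr (.inr (.inr (.inr (.inr (.inr (.inr (.inr (.inr (.inr
          (.inr (j, l)))))))))))))
  invFun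
    | .inl (i, j, l) => .c1 i j l
    | .inr (.inl (i, j, l)) => .c2 i j l
    | .inr (.inr (.inl (i, j, l))) => .c3 i j l
    | .inr (.inr (.inr (.inl (i, j, l)))) => .c4 i j l
    | .inr (.inr (.inr (.inr (.inl (i, l))))) => .c5 i l
    | .inr (.inr (.inr (.inr (.inr (.inl (j, l)))))) => .c6 j l
    | .inr (.inr (.inr (.inr (.inr (.inr (.inl l)))))) => .c7 l
    | .inr (.inr (.inr (.inr (.inr (.inr (.inr (.inl (i, j)))))))) => .c8 i j
    | .inr (.inr (.inr (.inr (.inr (.inr (.inr (.inr (.inl (i, l))))))))) => .c9 i l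
    | .inr (.inr (.inr (.inr (.inr (.inr (.inr (.inr (.inr (.inl (j, l)))))))))) => .c10 j l
    | .inr (.inr (.inr (.inr (.inr (.inr (.inr (.inr (.inr (.inr (.inl (i, j, l))))))))))) =>
        .c11 i j l
    | .inr (.inr (.inr (.inr (.inr (.inr (.inr (.inr (.inr (.inr (.inr
        (.inl (i, j, l)))))))))))) => .c12 i j l
    | .inr (.inr (.inr (.inr (.inr (.inr (.inr (.inr (.inr (.inr (.inr (.inr
        (.inl (i, l))))))))))))) => .c13 i l
    | .inr (.inr (.inr (.inr (.inr (.inr (.inr (.inr (.inr (.inr (.inr (.inr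
        (.inr (j, l))))))))))))) => .c14 j l
  left_inv s := by cases s <;> rfl
  right_inv s := by
    rcases s with _ | _ | _ | _ | _ | _ | _ | _ | _ | _ | _ | _ | _ | _ <;> rfl

theorem YState.sum_eq {N₁ N₂ k : ℕ} (f : YState N₁ N₂ k → ℝ) :
    ∑ s, f s = (∑ i, ∑ j, ∑ l, f (.c1 i j l)) + (∑ i, ∑ j, ∑ l, f (.c2 i j l)) +
      (∑ i, ∑ j, ∑ l, f (.c3 i j l)) + (∑ i, ∑ j, ∑ l, f (.c4 i j l)) +
      (∑ i, ∑ l, f (.c5 i l)) + (∑ j, ∑ l, f (.c6 j l)) + (∑ l, f (.c7 l)) +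
      (∑ i, ∑ j, f (.c8 i j)) + (∑ i, ∑ l, f (.c9 i l)) + (∑ j, ∑ l, f (.c10 j l)) +
      (∑ i, ∑ j, ∑ l, f (.c11 i j l)) + (∑ i, ∑ j, ∑ l, f (.c12 i j l)) +
      (∑ i, ∑ l, f (.c13 i l)) + (∑ j, ∑ l, f (.c14 j l)) := by
  rw [← (YState.equivSum N₁ N₂ k).symm.sum_comp]
  simp only [Fintype.sum_sum_type, Fintype.sum_prod_type, YState.equivSum, Equiv.coe_fn_symm_mk,
    add_assoc]

/-- The states of `W` as a sum type. -/
def WState.equivSum (N₁ N₂ k : ℕ) : WState N₁ N₂ k ≃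
    Fin k ⊕ (Fin N₁ × Fin k) ⊕ (Fin N₂ × Fin k) ⊕ (Fin N₁ × Fin N₂ × Fin k) where
  toFun
    | .c1 l => .inl l
    | .c2 i l => .inr (.inl (i, l))
    | .c3 j l => .inr (.inr (.inl (j, l)))
    | .c4 i j l => .inr (.inr (.inr (i, j, l)))
  invFun
    | .inl l => .c1 l
    | .inr (.inl (i, l)) => .c2 i l
    | .inr (.inr (.inl (j, l))) => .c3 j l
    | .inr (.inr (.inr (i, j, l))) => .c4 i j l
  left_inv s := by cases s <;> rfl
  right_inv s := by rcases s with _ | _ | _ | _ <;> rfl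

theorem WState.sum_eq {N₁ N₂ k : ℕ} (f : WState N₁ N₂ k → ℝ) :
    ∑ s, f s = (∑ l, f (.c1 l)) + (∑ i, ∑ l, f (.c2 i l)) + (∑ j, ∑ l, f (.c3 j l)) +
      (∑ i, ∑ j, ∑ l, f (.c4 i j l)) := by
  rw [← (WState.equivSum N₁ N₂ k).symm.sum_comp]
  simp only [Fintype.sum_sum_type, Fintype.sum_prod_type, WState.equivSum, Equiv.coe_fn_symm_mk,
    add_assoc]

/-! ### The clock -/

section Clock

variable {k : ℕ} {l : Fin k}

theorem tick_of_lt (h : (l : ℕ) + 1 < k) (l' : Fin k) :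
    tick l l' = if l' = ⟨l + 1, h⟩ then 1 else 0 := by
  simp only [tick, Fin.ext_iff]

theorem last_of_lt (h : (l : ℕ) + 1 < k) : last l = 0 := by
  simp [last, h.ne]

theorem wrap_of_lt (h : (l : ℕ) + 1 < k) (l' : Fin k) : wrap l l' = 0 := by
  simp [wrap, last_of_lt h]

theorem tickOrHold_of_lt (h : (l : ℕ) + 1 < k) (l' : Fin k) :
    tickOrHold l l' = if l' = ⟨l + 1, h⟩ then 1 else 0 := by
  rw [tickOrHold, last_of_lt h, tick_of_lt h]
  split_ifs with h1 h2 <;> simp_all [Fin.ext_iff]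

theorem tick_of_last (h : (l : ℕ) + 1 = k) (l' : Fin k) : tick l l' = 0 := by
  have := l'.2
  rw [tick, if_neg (by omega)]

theorem last_of_last (h : (l : ℕ) + 1 = k) : last l = 1 := by
  simp [last, h]

theorem wrap_of_last (h : (l : ℕ) + 1 = k) (l' : Fin k) :
    wrap l l' = if l' = ⟨0, l.pos⟩ then 1 else 0 := by
  simp only [wrap, last_of_last h, Fin.ext_iff]

theorem tickOrHold_of_last (h : (l : ℕ) + 1 = k) (l' : Fin k) :
    tickOrHold l l' = if l' = l then 1 else 0 := by
  simp only [tickOrHold, last_of_last h, tick_of_last h]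

end Clock

/-! ### One slot of the system -/

section Step

variable {N₁ N₂ k : ℕ}

/-- Expectation of `F` at slot `t + 1`, given the state `z` at slot `t`. -/
noncomputable def stepExp (pr : Server) (D₁ : DPH N₁) (D₂ : DPH N₂) (t : ℕ)
    (F : SysState N₁ N₂ k → ℝ) (z : SysState N₁ N₂ k) : ℝ :=
  ∑ o₁ : Option (Fin N₁), ∑ o₂ : Option (Fin N₂), ∑ e₁ : Fin N₁, ∑ e₂ : Fin N₂,
    serveProb D₁ z.srv₁ o₁ * serveProb D₂ z.srv₂ o₂ * D₁.α e₁ * D₂.α e₂ *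
      F (sysStep pr t z o₁ o₂ e₁ e₂)

/-- The outcomes are grouped by which servers remain busy. For an idle server the outcome `some i`
has `serveProb` zero, so the groups written with `afterService c (some i)` vanish there and one
formula covers busy and idle servers. -/
theorem stepExp_of_lt (pr : Server) (D₁ : DPH N₁) (D₂ : DPH N₂) (t : ℕ)
    (F : SysState N₁ N₂ k → ℝ) (c₁ : Option (Fin N₁ × ℤ)) (c₂ : Option (Fin N₂ × ℤ))
    (l : Fin k) (f : ℤ) (h : (l : ℕ) + 1 < k) :
    stepExp pr D₁ D₂ t F ⟨c₁, c₂, l, f⟩ =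
      (∑ i, ∑ j, serveProb D₁ c₁ (some i) * serveProb D₂ c₂ (some j) *
        F ⟨afterService c₁ (some i), afterService c₂ (some j), ⟨l + 1, h⟩,
          freshAfter (freshAfter f c₁ (some i)) c₂ (some j)⟩) +
      (∑ j, serveProb D₁ c₁ none * serveProb D₂ c₂ (some j) *
        F ⟨none, afterService c₂ (some j), ⟨l + 1, h⟩,
          freshAfter (freshAfter f c₁ none) c₂ (some j)⟩) +
      (∑ i, serveProb D₂ c₂ none * serveProb D₁ c₁ (some i) *
        F ⟨afterService c₁ (some i), none, ⟨l + 1, h⟩,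
          freshAfter (freshAfter f c₁ (some i)) c₂ none⟩) +
      serveProb D₁ c₁ none * serveProb D₂ c₂ none *
        F ⟨none, none, ⟨l + 1, h⟩, freshAfter (freshAfter f c₁ none) c₂ none⟩ := by
  -- Starting phases are drawn in every slot, used or not; unused ones sum out to one.
  have key : ∀ c x : ℝ, ∑ e₁, ∑ e₂, c * D₁.α e₁ * D₂.α e₂ * x = c * x := by
    intro c x
    simp_rw [← Finset.sum_mul, ← Finset.mul_sum, D₂.α_sum, mul_one, ← Finset.mul_sum, D₁.α_sum,
      mul_one]
  have h₁ : afterService c₁ none = none := by cases c₁ <;> rfl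
  have h₂ : afterService c₂ none = none := by cases c₂ <;> rfl
  simp only [stepExp, sysStep, h, dite_true, key, Fintype.sum_option, Finset.sum_add_distrib,
    h₁, h₂]
  ring_nf

theorem stepExp_of_last (pr : Server) (D₁ : DPH N₁) (D₂ : DPH N₂) (t : ℕ)
    (F : SysState N₁ N₂ k → ℝ) (c₁ : Option (Fin N₁ × ℤ)) (c₂ : Option (Fin N₂ × ℤ))
    (l : Fin k) (f : ℤ) (h : (l : ℕ) + 1 = k) :
    stepExp pr D₁ D₂ t F ⟨c₁, c₂, l, f⟩ =
      (∑ i, ∑ j, serveProb D₁ c₁ (some i) * serveProb D₂ c₂ (some j) *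
        F ⟨afterService c₁ (some i), afterService c₂ (some j), l,
          freshAfter (freshAfter f c₁ (some i)) c₂ (some j)⟩) +
      (∑ i, ∑ j, serveProb D₁ c₁ none * serveProb D₂ c₂ (some j) * D₁.α i *
        F ⟨some (i, (t : ℤ) + 1), afterService c₂ (some j), ⟨0, l.pos⟩,
          freshAfter (freshAfter f c₁ none) c₂ (some j)⟩) +
      (∑ i, ∑ j, serveProb D₂ c₂ none * serveProb D₁ c₁ (some i) * D₂.α j *
        F ⟨afterService c₁ (some i), some (j, (t : ℤ) + 1), ⟨0, l.pos⟩,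
          freshAfter (freshAfter f c₁ (some i)) c₂ none⟩) +
      (∑ i, prio₁ pr * serveProb D₁ c₁ none * serveProb D₂ c₂ none * D₁.α i *
        F ⟨some (i, (t : ℤ) + 1), none, ⟨0, l.pos⟩,
          freshAfter (freshAfter f c₁ none) c₂ none⟩) +
      (∑ j, prio₂ pr * serveProb D₁ c₁ none * serveProb D₂ c₂ none * D₂.α j *
        F ⟨none, some (j, (t : ℤ) + 1), ⟨0, l.pos⟩,
          freshAfter (freshAfter f c₁ none) c₂ none⟩) := by
  have key : ∀ c x : ℝ, ∑ e₁, ∑ e₂, c * D₁.α e₁ * D₂.α e₂ * x = c * x := by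
    intro c x
    simp_rw [← Finset.sum_mul, ← Finset.mul_sum, D₂.α_sum, mul_one, ← Finset.mul_sum, D₁.α_sum,
      mul_one]
  have key₁ : ∀ (c : ℝ) (x : Fin N₁ → ℝ),
      ∑ e₁, ∑ e₂, c * D₁.α e₁ * D₂.α e₂ * x e₁ = ∑ e₁, c * D₁.α e₁ * x e₁ := by
    intro c x
    simp_rw [← Finset.sum_mul, ← Finset.mul_sum, D₂.α_sum, mul_one]
  have key₂ : ∀ (c : ℝ) (x : Fin N₂ → ℝ),
      ∑ e₁, ∑ e₂, c * D₁.α e₁ * D₂.α e₂ * x e₂ = ∑ e₂, c * D₂.α e₂ * x e₂ := by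
    intro c x
    rw [Finset.sum_comm]
    simp_rw [← Finset.sum_mul, ← Finset.mul_sum, D₁.α_sum, mul_one]
  have hl : ¬ (l : ℕ) + 1 < k := by omega
  have comm : ∀ x : Fin N₂ → Fin N₁ → ℝ, ∑ j, ∑ i, x j i = ∑ i, ∑ j, x j i := fun x =>
    Finset.sum_comm
  cases pr <;> rcases c₁ with _ | ⟨i₀, a⟩ <;> rcases c₂ with _ | ⟨j₀, b⟩ <;>
  simp [stepExp, sysStep, hl, Fintype.sum_option, Finset.sum_add_distrib,
    afterService, serveProb, prio₁, prio₂, key, key₁, key₂] <;>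
  (try rw [comm]) <;> (try ring_nf)

end Step

theorem Fin.lt_or_last {k : ℕ} (l : Fin k) : (l : ℕ) + 1 < k ∨ (l : ℕ) + 1 = k := by
  have := l.2
  omega

/-! ### One slot of `Y` -/

section AbsorbingChain

variable {N₁ N₂ k : ℕ} (pr : Server) (D₁ : DPH N₁) (D₂ : DPH N₂) (u : YState N₁ N₂ k → ℝ)

set_option linter.unusedSimpArgs false

/-- Each row of `A` is sorted into a `tick` part and a `last` part, exactly one of which survives
once the clock value is known. The action on column vectors is what both the lumping identities and
the transience argument use. -/
theorem amcA_mulVec_c1 (i : Fin N₁) (j : Fin N₂) (l : Fin k) :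
    (amcA k pr D₁ D₂ *ᵥ u) (.c1 i j l) =
      (∑ l', tick l l' *
        ((∑ j', D₁.b i * D₂.B j j' * u (.c10 j' l')) +
         (D₁.b i * D₂.b j * u (.c7 l')) +
         (∑ i', D₂.b j * D₁.B i i' * u (.c5 i' l')) +
         (∑ i', ∑ j', D₁.B i i' * D₂.B j j' * u (.c1 i' j' l')))) +
      last l *
        ((∑ i', ∑ j', D₁.b i * D₂.B j j' * D₁.α i' * u (.c11 i' j' ⟨0, l.pos⟩)) +
         (∑ i', prio₁ pr * D₁.b i * D₂.b j * D₁.α i' * u (.c13 i' ⟨0, l.pos⟩)) +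
         (∑ j', prio₂ pr * D₁.b i * D₂.b j * D₂.α j' * u (.c14 j' ⟨0, l.pos⟩)) +
         (∑ i', ∑ j', D₂.b j * D₁.B i i' * D₂.α j' * u (.c2 i' j' ⟨0, l.pos⟩)) +
         (∑ i', ∑ j', D₁.B i i' * D₂.B j j' * u (.c1 i' j' l))) := by
  rcases l.lt_or_last with h | h
  · simp [mulVec, dotProduct, amcA, amcTrans, YState.sum_eq, tick_of_lt h, wrap_of_lt h,
      last_of_lt h, tickOrHold_of_lt h]
    try ring
  · simp [mulVec, dotProduct, amcA, amcTrans, YState.sum_eq, tick_of_last h, wrap_of_last h,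
      last_of_last h, tickOrHold_of_last h]
    try ring_nf

theorem amcA_mulVec_c2 (i : Fin N₁) (j : Fin N₂) (l : Fin k) :
    (amcA k pr D₁ D₂ *ᵥ u) (.c2 i j l) =
      (∑ l', tick l l' *
        ((∑ j', D₁.b i * D₂.B j j' * u (.c14 j' l')) +
         (∑ i', ∑ j', D₁.B i i' * D₂.B j j' * u (.c2 i' j' l')))) +
      last l *
        ((∑ i', ∑ j', D₁.b i * D₂.B j j' * D₁.α i' * u (.c8 i' j')) +
         (∑ i', ∑ j', D₁.B i i' * D₂.B j j' * u (.c2 i' j' l))) := by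
  rcases l.lt_or_last with h | h
  · simp [mulVec, dotProduct, amcA, amcTrans, YState.sum_eq, tick_of_lt h, wrap_of_lt h,
      last_of_lt h, tickOrHold_of_lt h]
    try ring
  · simp [mulVec, dotProduct, amcA, amcTrans, YState.sum_eq, tick_of_last h, wrap_of_last h,
      last_of_last h, tickOrHold_of_last h]
    try ring_nf

theorem amcA_mulVec_c3 (i : Fin N₁) (j : Fin N₂) (l : Fin k) :
    (amcA k pr D₁ D₂ *ᵥ u) (.c3 i j l) =
      (∑ l', tick l l' *
        ((∑ i', D₂.b j * D₁.B i i' * u (.c13 i' l')) +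
         (∑ i', ∑ j', D₁.B i i' * D₂.B j j' * u (.c3 i' j' l')))) +
      last l *
        ((∑ i', ∑ j', D₂.b j * D₁.B i i' * D₂.α j' * u (.c8 i' j')) +
         (∑ i', ∑ j', D₁.B i i' * D₂.B j j' * u (.c3 i' j' l))) := by
  rcases l.lt_or_last with h | h
  · simp [mulVec, dotProduct, amcA, amcTrans, YState.sum_eq, tick_of_lt h, wrap_of_lt h,
      last_of_lt h, tickOrHold_of_lt h]
    try ring
  · simp [mulVec, dotProduct, amcA, amcTrans, YState.sum_eq, tick_of_last h, wrap_of_last h,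
      last_of_last h, tickOrHold_of_last h]
    try ring_nf

theorem amcA_mulVec_c4 (i : Fin N₁) (j : Fin N₂) (l : Fin k) :
    (amcA k pr D₁ D₂ *ᵥ u) (.c4 i j l) =
      (∑ l', tick l l' *
        ((∑ j', D₁.b i * D₂.B j j' * u (.c6 j' l')) +
         (D₁.b i * D₂.b j * u (.c7 l')) +
         (∑ i', D₂.b j * D₁.B i i' * u (.c9 i' l')) +
         (∑ i', ∑ j', D₁.B i i' * D₂.B j j' * u (.c4 i' j' l')))) +
      last l *
        ((∑ i', ∑ j', D₁.b i * D₂.B j j' * D₁.α i' * u (.c3 i' j' ⟨0, l.pos⟩)) +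
         (∑ i', prio₁ pr * D₁.b i * D₂.b j * D₁.α i' * u (.c13 i' ⟨0, l.pos⟩)) +
         (∑ j', prio₂ pr * D₁.b i * D₂.b j * D₂.α j' * u (.c14 j' ⟨0, l.pos⟩)) +
         (∑ i', ∑ j', D₂.b j * D₁.B i i' * D₂.α j' * u (.c12 i' j' ⟨0, l.pos⟩)) +
         (∑ i', ∑ j', D₁.B i i' * D₂.B j j' * u (.c4 i' j' l))) := by
  rcases l.lt_or_last with h | h
  · simp [mulVec, dotProduct, amcA, amcTrans, YState.sum_eq, tick_of_lt h, wrap_of_lt h,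
      last_of_lt h, tickOrHold_of_lt h]
    try ring
  · simp [mulVec, dotProduct, amcA, amcTrans, YState.sum_eq, tick_of_last h, wrap_of_last h,
      last_of_last h, tickOrHold_of_last h]
    try ring_nf

theorem amcA_mulVec_c5 (i : Fin N₁) (l : Fin k) :
    (amcA k pr D₁ D₂ *ᵥ u) (.c5 i l) =
      (∑ l', tick l l' *
        ((D₁.b i * u (.c7 l')) +
         (∑ i', D₁.B i i' * u (.c5 i' l')))) +
      last l *
        ((∑ i', prio₁ pr * D₁.b i * D₁.α i' * u (.c13 i' ⟨0, l.pos⟩)) +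
         (∑ j', prio₂ pr * D₁.b i * D₂.α j' * u (.c14 j' ⟨0, l.pos⟩)) +
         (∑ i', ∑ j', D₁.B i i' * D₂.α j' * u (.c2 i' j' ⟨0, l.pos⟩))) := by
  rcases l.lt_or_last with h | h
  · simp [mulVec, dotProduct, amcA, amcTrans, YState.sum_eq, tick_of_lt h, wrap_of_lt h,
      last_of_lt h, tickOrHold_of_lt h]
    try ring
  · simp [mulVec, dotProduct, amcA, amcTrans, YState.sum_eq, tick_of_last h, wrap_of_last h,
      last_of_last h, tickOrHold_of_last h]
    try ring_nf

theorem amcA_mulVec_c6 (j : Fin N₂) (l : Fin k) :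
    (amcA k pr D₁ D₂ *ᵥ u) (.c6 j l) =
      (∑ l', tick l l' *
        ((D₂.b j * u (.c7 l')) +
         (∑ j', D₂.B j j' * u (.c6 j' l')))) +
      last l *
        ((∑ i', prio₁ pr * D₂.b j * D₁.α i' * u (.c13 i' ⟨0, l.pos⟩)) +
         (∑ j', prio₂ pr * D₂.b j * D₂.α j' * u (.c14 j' ⟨0, l.pos⟩)) +
         (∑ i', ∑ j', D₂.B j j' * D₁.α i' * u (.c3 i' j' ⟨0, l.pos⟩))) := by
  rcases l.lt_or_last with h | h
  · simp [mulVec, dotProduct, amcA, amcTrans, YState.sum_eq, tick_of_lt h, wrap_of_lt h,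
      last_of_lt h, tickOrHold_of_lt h]
    try ring
  · simp [mulVec, dotProduct, amcA, amcTrans, YState.sum_eq, tick_of_last h, wrap_of_last h,
      last_of_last h, tickOrHold_of_last h]
    try ring_nf

theorem amcA_mulVec_c7 (l : Fin k) :
    (amcA k pr D₁ D₂ *ᵥ u) (.c7 l) =
      (∑ l', tick l l' *
        (u (.c7 l'))) +
      last l *
        ((∑ i', prio₁ pr * D₁.α i' * u (.c13 i' ⟨0, l.pos⟩)) +
         (∑ j', prio₂ pr * D₂.α j' * u (.c14 j' ⟨0, l.pos⟩))) := by
  rcases l.lt_or_last with h | h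
  · simp [mulVec, dotProduct, amcA, amcTrans, YState.sum_eq, tick_of_lt h, wrap_of_lt h,
      last_of_lt h, tickOrHold_of_lt h]
    try ring
  · simp [mulVec, dotProduct, amcA, amcTrans, YState.sum_eq, tick_of_last h, wrap_of_last h,
      last_of_last h, tickOrHold_of_last h]
    try ring_nf

theorem amcA_mulVec_c8 (i : Fin N₁) (j : Fin N₂) :
    (amcA k pr D₁ D₂ *ᵥ u) (.c8 i j) =
      ∑ i', ∑ j', D₁.B i i' * D₂.B j j' * u (.c8 i' j') := by
  simp [mulVec, dotProduct, amcA, amcTrans, YState.sum_eq]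

theorem amcA_mulVec_c9 (i : Fin N₁) (l : Fin k) :
    (amcA k pr D₁ D₂ *ᵥ u) (.c9 i l) =
      (∑ l', tick l l' *
        ((D₁.b i * u (.c7 l')) +
         (∑ i', D₁.B i i' * u (.c9 i' l')))) +
      last l *
        ((∑ i', prio₁ pr * D₁.b i * D₁.α i' * u (.c13 i' ⟨0, l.pos⟩)) +
         (∑ j', prio₂ pr * D₁.b i * D₂.α j' * u (.c14 j' ⟨0, l.pos⟩)) +
         (∑ i', ∑ j', D₁.B i i' * D₂.α j' * u (.c12 i' j' ⟨0, l.pos⟩))) := by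
  rcases l.lt_or_last with h | h
  · simp [mulVec, dotProduct, amcA, amcTrans, YState.sum_eq, tick_of_lt h, wrap_of_lt h,
      last_of_lt h, tickOrHold_of_lt h]
    try ring
  · simp [mulVec, dotProduct, amcA, amcTrans, YState.sum_eq, tick_of_last h, wrap_of_last h,
      last_of_last h, tickOrHold_of_last h]
    try ring_nf

theorem amcA_mulVec_c10 (j : Fin N₂) (l : Fin k) :
    (amcA k pr D₁ D₂ *ᵥ u) (.c10 j l) =
      (∑ l', tick l l' *
        ((D₂.b j * u (.c7 l')) +
         (∑ j', D₂.B j j' * u (.c10 j' l')))) +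
      last l *
        ((∑ i', prio₁ pr * D₂.b j * D₁.α i' * u (.c13 i' ⟨0, l.pos⟩)) +
         (∑ j', prio₂ pr * D₂.b j * D₂.α j' * u (.c14 j' ⟨0, l.pos⟩)) +
         (∑ i', ∑ j', D₂.B j j' * D₁.α i' * u (.c11 i' j' ⟨0, l.pos⟩))) := by
  rcases l.lt_or_last with h | h
  · simp [mulVec, dotProduct, amcA, amcTrans, YState.sum_eq, tick_of_lt h, wrap_of_lt h,
      last_of_lt h, tickOrHold_of_lt h]
    try ring
  · simp [mulVec, dotProduct, amcA, amcTrans, YState.sum_eq, tick_of_last h, wrap_of_last h,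
      last_of_last h, tickOrHold_of_last h]
    try ring_nf

theorem amcA_mulVec_c11 (i : Fin N₁) (j : Fin N₂) (l : Fin k) :
    (amcA k pr D₁ D₂ *ᵥ u) (.c11 i j l) =
      (∑ l', tick l l' *
        ((∑ i', D₂.b j * D₁.B i i' * u (.c13 i' l')) +
         (∑ i', ∑ j', D₁.B i i' * D₂.B j j' * u (.c11 i' j' l')))) +
      last l *
        ((∑ i', ∑ j', D₂.b j * D₁.B i i' * D₂.α j' * u (.c8 i' j')) +
         (∑ i', ∑ j', D₁.B i i' * D₂.B j j' * u (.c11 i' j' l))) := by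
  rcases l.lt_or_last with h | h
  · simp [mulVec, dotProduct, amcA, amcTrans, YState.sum_eq, tick_of_lt h, wrap_of_lt h,
      last_of_lt h, tickOrHold_of_lt h]
    try ring
  · simp [mulVec, dotProduct, amcA, amcTrans, YState.sum_eq, tick_of_last h, wrap_of_last h,
      last_of_last h, tickOrHold_of_last h]
    try ring_nf

theorem amcA_mulVec_c12 (i : Fin N₁) (j : Fin N₂) (l : Fin k) :
    (amcA k pr D₁ D₂ *ᵥ u) (.c12 i j l) =
      (∑ l', tick l l' *
        ((∑ j', D₁.b i * D₂.B j j' * u (.c14 j' l')) +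
         (∑ i', ∑ j', D₁.B i i' * D₂.B j j' * u (.c12 i' j' l')))) +
      last l *
        ((∑ i', ∑ j', D₁.b i * D₂.B j j' * D₁.α i' * u (.c8 i' j')) +
         (∑ i', ∑ j', D₁.B i i' * D₂.B j j' * u (.c12 i' j' l))) := by
  rcases l.lt_or_last with h | h
  · simp [mulVec, dotProduct, amcA, amcTrans, YState.sum_eq, tick_of_lt h, wrap_of_lt h,
      last_of_lt h, tickOrHold_of_lt h]
    try ring
  · simp [mulVec, dotProduct, amcA, amcTrans, YState.sum_eq, tick_of_last h, wrap_of_last h,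
      last_of_last h, tickOrHold_of_last h]
    try ring_nf

theorem amcA_mulVec_c13 (i : Fin N₁) (l : Fin k) :
    (amcA k pr D₁ D₂ *ᵥ u) (.c13 i l) =
      (∑ l', tick l l' *
        ((∑ i', D₁.B i i' * u (.c13 i' l')))) +
      last l *
        ((∑ i', ∑ j', D₁.B i i' * D₂.α j' * u (.c8 i' j'))) := by
  rcases l.lt_or_last with h | h
  · simp [mulVec, dotProduct, amcA, amcTrans, YState.sum_eq, tick_of_lt h, wrap_of_lt h,
      last_of_lt h, tickOrHold_of_lt h]
    try ring
  · simp [mulVec, dotProduct, amcA, amcTrans, YState.sum_eq, tick_of_last h, wrap_of_last h,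
      last_of_last h, tickOrHold_of_last h]
    try ring_nf

theorem amcA_mulVec_c14 (j : Fin N₂) (l : Fin k) :
    (amcA k pr D₁ D₂ *ᵥ u) (.c14 j l) =
      (∑ l', tick l l' *
        ((∑ j', D₂.B j j' * u (.c14 j' l')))) +
      last l *
        ((∑ i', ∑ j', D₂.B j j' * D₁.α i' * u (.c8 i' j'))) := by
  rcases l.lt_or_last with h | h
  · simp [mulVec, dotProduct, amcA, amcTrans, YState.sum_eq, tick_of_lt h, wrap_of_lt h,
      last_of_lt h, tickOrHold_of_lt h]
    try ring
  · simp [mulVec, dotProduct, amcA, amcTrans, YState.sum_eq, tick_of_last h, wrap_of_last h,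
      last_of_last h, tickOrHold_of_last h]
    try ring_nf

end AbsorbingChain

/-! ### Projections of the system onto `Y` and `W` -/

section Lumping

variable {N₁ N₂ k : ℕ}

/-- The state of `Y` that corresponds to `z`, if `P*` is the packet generated at instant `g`. -/
def trackClass (g : ℤ) (z : SysState N₁ N₂ k) : Option (YState N₁ N₂ k) :=
  if g < z.fresh then none
  else if g ≤ z.fresh then
    match z.srv₁, z.srv₂ with
    | none, none => some (.c7 z.clock)
    | some (i, a), none => some (if g < a then .c13 i z.clock else .c9 i z.clock)
    | none, some (j, b) => some (if g < b then .c14 j z.clock else .c10 j z.clock)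
    | some (i, a), some (j, b) =>
      if g < a then some (if g < b then .c8 i j else .c11 i j z.clock)
      else if g < b then some (.c12 i j z.clock) else none
  else
    match z.srv₁, z.srv₂ with
    | none, none => none
    | some (i, a), none => if a = g then some (.c5 i z.clock) else none
    | none, some (j, b) => if b = g then some (.c6 j z.clock) else none
    | some (i, a), some (j, b) =>
      if a = g then some (if g < b then .c2 i j z.clock else .c1 i j z.clock)
      else if b = g then some (if g < a then .c3 i j z.clock else .c4 i j z.clock)
      else none

/-- Properties of the generation instants in the states that are reached by slot `t`. -/
structure SysState.Admissible (t : ℤ) (z : SysState N₁ N₂ k) : Prop where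
  fresh_le : z.fresh ≤ t
  srv₁_le : ∀ x ∈ z.srv₁, x.2 ≤ t
  srv₂_le : ∀ y ∈ z.srv₂, y.2 ≤ t
  both : ∀ x ∈ z.srv₁, ∀ y ∈ z.srv₂, (z.fresh ≤ 0 ∨ z.fresh < max x.2 y.2) ∧ (x.2 = y.2 → x.2 ≤ 0)

set_option linter.unusedSimpArgs false

-- Lumpability in dual form. The value `none` of `trackClass` covers absorption and the absence of a
-- packet generated at `g`; both persist, so they contribute `0`. Only with two busy servers is
-- `Admissible` needed: it excludes two obsolete packets after the reception of `P*`, and two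
-- packets both generated at `g`, for which `Y` has no state.
set_option maxHeartbeats 1000000 in
theorem stepExp_trackClass_both (pr : Server) (D₁ : DPH N₁) (D₂ : DPH N₂) {t : ℕ} {g : ℤ}
    (hgt : g ≤ t) (u : YState N₁ N₂ k → ℝ)
    (i : Fin N₁) (a : ℤ) (j : Fin N₂) (b : ℤ)
    (l : Fin k) (f : ℤ) (hg : 1 ≤ g)
    (hz : (⟨some (i, a), some (j, b), l, f⟩ : SysState N₁ N₂ k).Admissible t) :
    stepExp pr D₁ D₂ t (fun z => (trackClass g z).elim 0 u) ⟨some (i, a), some (j, b), l, f⟩ =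
      (trackClass g ⟨some (i, a), some (j, b), l, f⟩).elim 0 (amcA k pr D₁ D₂ *ᵥ u) := by
  obtain ⟨-, -, -, h2⟩ := hz
  simp only [Option.mem_def, Option.some.injEq, forall_eq', lt_max_iff] at h2
  -- A packet generated in the next slot is newer than `P*`. This and the two variants below settle
  -- every comparison of `g` with `t + 1`.
  have h3 : g < (t : ℤ) + 1 := by omega
  have h4 := h3.le
  have h5 := h3.ne'
  rcases l.lt_or_last with h | h
  · rw [stepExp_of_lt _ _ _ _ _ _ _ _ _ h]
    simp only [serveProb, afterService, freshAfter, trackClass]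
    rcases lt_trichotomy f g with hf | hf | hf
    all_goals rcases lt_trichotomy a g with ha | ha | ha
    all_goals rcases lt_trichotomy b g with hb | hb | hb
    -- The configurations contradicting admissibility are closed by `omega`, with `1 ≤ g`; in the
    -- others `h2` is dropped so that `simp [*]` does not use it.
    all_goals first
      | (exfalso; omega)
      | clear h2
    all_goals simp [*, le_of_lt, ne_of_lt, ne_of_gt, not_le_of_gt, not_lt_of_ge,
      amcA_mulVec_c1, amcA_mulVec_c2, amcA_mulVec_c3, amcA_mulVec_c4, amcA_mulVec_c8, amcA_mulVec_c11, amcA_mulVec_c12, tick_of_lt h, last_of_lt h]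
    all_goals ring
  · rw [stepExp_of_last _ _ _ _ _ _ _ _ _ h]
    simp only [serveProb, afterService, freshAfter, trackClass]
    rcases lt_trichotomy f g with hf | hf | hf
    all_goals rcases lt_trichotomy a g with ha | ha | ha
    all_goals rcases lt_trichotomy b g with hb | hb | hb
    all_goals first
      | (exfalso; omega)
      | clear h2
    all_goals simp [*, le_of_lt, ne_of_lt, ne_of_gt, not_le_of_gt, not_lt_of_ge,
      amcA_mulVec_c1, amcA_mulVec_c2, amcA_mulVec_c3, amcA_mulVec_c4, amcA_mulVec_c8, amcA_mulVec_c11, amcA_mulVec_c12, tick_of_last h, last_of_last h]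
    all_goals ring

set_option maxHeartbeats 1000000 in
theorem stepExp_trackClass_left (pr : Server) (D₁ : DPH N₁) (D₂ : DPH N₂) {t : ℕ} {g : ℤ}
    (hgt : g ≤ t) (u : YState N₁ N₂ k → ℝ)
    (i : Fin N₁) (a : ℤ)
    (l : Fin k) (f : ℤ) :
    stepExp pr D₁ D₂ t (fun z => (trackClass g z).elim 0 u) ⟨some (i, a), none, l, f⟩ =
      (trackClass g ⟨some (i, a), none, l, f⟩).elim 0 (amcA k pr D₁ D₂ *ᵥ u) := by
  have h3 : g < (t : ℤ) + 1 := by omega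
  have h4 := h3.le
  have h5 := h3.ne'
  rcases l.lt_or_last with h | h
  · rw [stepExp_of_lt _ _ _ _ _ _ _ _ _ h]
    simp only [serveProb, afterService, freshAfter, trackClass]
    rcases lt_trichotomy f g with hf | hf | hf
    all_goals rcases lt_trichotomy a g with ha | ha | ha
    all_goals simp [*, le_of_lt, ne_of_lt, ne_of_gt, not_le_of_gt, not_lt_of_ge,
      amcA_mulVec_c5, amcA_mulVec_c9, amcA_mulVec_c13, tick_of_lt h, last_of_lt h]
    all_goals ring
  · rw [stepExp_of_last _ _ _ _ _ _ _ _ _ h]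
    simp only [serveProb, afterService, freshAfter, trackClass]
    rcases lt_trichotomy f g with hf | hf | hf
    all_goals rcases lt_trichotomy a g with ha | ha | ha
    all_goals simp [*, le_of_lt, ne_of_lt, ne_of_gt, not_le_of_gt, not_lt_of_ge,
      amcA_mulVec_c5, amcA_mulVec_c9, amcA_mulVec_c13, tick_of_last h, last_of_last h]
    all_goals ring

set_option maxHeartbeats 1000000 in
theorem stepExp_trackClass_right (pr : Server) (D₁ : DPH N₁) (D₂ : DPH N₂) {t : ℕ} {g : ℤ}
    (hgt : g ≤ t) (u : YState N₁ N₂ k → ℝ)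
    (j : Fin N₂) (b : ℤ)
    (l : Fin k) (f : ℤ) :
    stepExp pr D₁ D₂ t (fun z => (trackClass g z).elim 0 u) ⟨none, some (j, b), l, f⟩ =
      (trackClass g ⟨none, some (j, b), l, f⟩).elim 0 (amcA k pr D₁ D₂ *ᵥ u) := by
  have h3 : g < (t : ℤ) + 1 := by omega
  have h4 := h3.le
  have h5 := h3.ne'
  rcases l.lt_or_last with h | h
  · rw [stepExp_of_lt _ _ _ _ _ _ _ _ _ h]
    simp only [serveProb, afterService, freshAfter, trackClass]
    rcases lt_trichotomy f g with hf | hf | hf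
    all_goals rcases lt_trichotomy b g with hb | hb | hb
    all_goals simp [*, le_of_lt, ne_of_lt, ne_of_gt, not_le_of_gt, not_lt_of_ge,
      amcA_mulVec_c6, amcA_mulVec_c10, amcA_mulVec_c14, tick_of_lt h, last_of_lt h]
    all_goals ring
  · rw [stepExp_of_last _ _ _ _ _ _ _ _ _ h]
    simp only [serveProb, afterService, freshAfter, trackClass]
    rcases lt_trichotomy f g with hf | hf | hf
    all_goals rcases lt_trichotomy b g with hb | hb | hb
    all_goals simp [*, le_of_lt, ne_of_lt, ne_of_gt, not_le_of_gt, not_lt_of_ge,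
      amcA_mulVec_c6, amcA_mulVec_c10, amcA_mulVec_c14, tick_of_last h, last_of_last h]
    all_goals ring

set_option maxHeartbeats 1000000 in
theorem stepExp_trackClass_idle (pr : Server) (D₁ : DPH N₁) (D₂ : DPH N₂) {t : ℕ} {g : ℤ}
    (hgt : g ≤ t) (u : YState N₁ N₂ k → ℝ)
    (l : Fin k) (f : ℤ) :
    stepExp pr D₁ D₂ t (fun z => (trackClass g z).elim 0 u) ⟨none, none, l, f⟩ =
      (trackClass g ⟨none, none, l, f⟩).elim 0 (amcA k pr D₁ D₂ *ᵥ u) := by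
  have h3 : g < (t : ℤ) + 1 := by omega
  have h4 := h3.le
  have h5 := h3.ne'
  rcases l.lt_or_last with h | h
  · rw [stepExp_of_lt _ _ _ _ _ _ _ _ _ h]
    simp only [serveProb, afterService, freshAfter, trackClass]
    rcases lt_trichotomy f g with hf | hf | hf
    all_goals simp [*, le_of_lt, ne_of_lt, ne_of_gt, not_le_of_gt, not_lt_of_ge,
      amcA_mulVec_c7, tick_of_lt h, last_of_lt h]
  · rw [stepExp_of_last _ _ _ _ _ _ _ _ _ h]
    simp only [serveProb, afterService, freshAfter, trackClass]
    rcases lt_trichotomy f g with hf | hf | hf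
    all_goals simp [*, le_of_lt, ne_of_lt, ne_of_gt, not_le_of_gt, not_lt_of_ge,
      amcA_mulVec_c7, tick_of_last h, last_of_last h]

theorem stepExp_trackClass (pr : Server) (D₁ : DPH N₁) (D₂ : DPH N₂) {t : ℕ} {g : ℤ}
    (hg : 1 ≤ g) (hgt : g ≤ t) (u : YState N₁ N₂ k → ℝ) {z : SysState N₁ N₂ k}
    (hz : z.Admissible t) :
    stepExp pr D₁ D₂ t (fun z => (trackClass g z).elim 0 u) z =
      (trackClass g z).elim 0 (amcA k pr D₁ D₂ *ᵥ u) := by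
  obtain ⟨_ | ⟨i, a⟩, _ | ⟨j, b⟩, l, f⟩ := z
  · exact stepExp_trackClass_idle pr D₁ D₂ hgt u l f
  · exact stepExp_trackClass_right pr D₁ D₂ hgt u j b l f
  · exact stepExp_trackClass_left pr D₁ D₂ hgt u i a l f
  · exact stepExp_trackClass_both pr D₁ D₂ hgt u i a j b l f hg hz

/-- The non-`P*` states are those in which `P*` itself is the freshest received packet.
Admissibility rules out the configuration with `fresh = g` and two obsolete packets, which
`trackClass` sends to `none`. -/
theorem trackClass_elim_amcV {t g : ℤ} (hg : 1 ≤ g) {z : SysState N₁ N₂ k}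
    (hz : z.Admissible t) :
    (trackClass g z).elim 0 (amcV N₁ N₂ k) = if z.fresh = g then 1 else 0 := by
  obtain ⟨-, -, -, h2⟩ := hz
  obtain ⟨_ | ⟨i, a⟩, _ | ⟨j, b⟩, l, f⟩ := z
  all_goals simp only [Option.mem_def, Option.some.injEq, forall_eq', lt_max_iff] at h2
  all_goals
    simp only [trackClass]
    split_ifs <;> first | (exfalso; omega) | simp [amcV, nonPStar]

/-- The state of `Y` that describes `z` if all packets generated by the instant `g` are
considered as obsolete. -/
def staleClass (g : ℤ) (z : SysState N₁ N₂ k) : Option (YState N₁ N₂ k) :=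
  if g < z.fresh then none
  else
    match z.srv₁, z.srv₂ with
    | none, none => some (.c7 z.clock)
    | some (i, a), none => some (if g < a then .c13 i z.clock else .c5 i z.clock)
    | none, some (j, b) => some (if g < b then .c14 j z.clock else .c10 j z.clock)
    | some (i, a), some (j, b) =>
      some (if g < a then (if g < b then .c8 i j else .c11 i j z.clock)
        else if g < b then .c2 i j z.clock else .c1 i j z.clock)

-- A lumping used only to bound the tail of the age. Two obsolete packets have no state of their own
-- in `Y`, but with absorption of either kind counted alike, `c1` has the right dynamics. Its
-- successors are `c5` and `c2` when `S₁` holds the obsolete packet and `c10` and `c11` when `S₂`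
-- does, whence the asymmetric labels. No admissibility is required.
set_option maxHeartbeats 1000000 in
theorem stepExp_staleClass_both (pr : Server) (D₁ : DPH N₁) (D₂ : DPH N₂) {t : ℕ} {g : ℤ}
    (hgt : g ≤ t) (u : YState N₁ N₂ k → ℝ)
    (i : Fin N₁) (a : ℤ) (j : Fin N₂) (b : ℤ)
    (l : Fin k) (f : ℤ) :
    stepExp pr D₁ D₂ t (fun z => (staleClass g z).elim 0 u) ⟨some (i, a), some (j, b), l, f⟩ =
      (staleClass g ⟨some (i, a), some (j, b), l, f⟩).elim 0 (amcA k pr D₁ D₂ *ᵥ u) := by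
  have h3 : g < (t : ℤ) + 1 := by omega
  have h4 := h3.le
  have h5 := h3.ne'
  rcases l.lt_or_last with h | h
  · rw [stepExp_of_lt _ _ _ _ _ _ _ _ _ h]
    simp only [serveProb, afterService, freshAfter, staleClass]
    rcases lt_trichotomy f g with hf | hf | hf
    all_goals rcases lt_trichotomy a g with ha | ha | ha
    all_goals rcases lt_trichotomy b g with hb | hb | hb
    all_goals simp [*, le_of_lt, ne_of_lt, ne_of_gt, not_le_of_gt, not_lt_of_ge,
      amcA_mulVec_c1, amcA_mulVec_c2, amcA_mulVec_c8, amcA_mulVec_c11, tick_of_lt h, last_of_lt h]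
    all_goals ring
  · rw [stepExp_of_last _ _ _ _ _ _ _ _ _ h]
    simp only [serveProb, afterService, freshAfter, staleClass]
    rcases lt_trichotomy f g with hf | hf | hf
    all_goals rcases lt_trichotomy a g with ha | ha | ha
    all_goals rcases lt_trichotomy b g with hb | hb | hb
    all_goals simp [*, le_of_lt, ne_of_lt, ne_of_gt, not_le_of_gt, not_lt_of_ge,
      amcA_mulVec_c1, amcA_mulVec_c2, amcA_mulVec_c8, amcA_mulVec_c11, tick_of_last h, last_of_last h]
    all_goals ring

set_option maxHeartbeats 1000000 in
theorem stepExp_staleClass_left (pr : Server) (D₁ : DPH N₁) (D₂ : DPH N₂) {t : ℕ} {g : ℤ}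
    (hgt : g ≤ t) (u : YState N₁ N₂ k → ℝ)
    (i : Fin N₁) (a : ℤ)
    (l : Fin k) (f : ℤ) :
    stepExp pr D₁ D₂ t (fun z => (staleClass g z).elim 0 u) ⟨some (i, a), none, l, f⟩ =
      (staleClass g ⟨some (i, a), none, l, f⟩).elim 0 (amcA k pr D₁ D₂ *ᵥ u) := by
  have h3 : g < (t : ℤ) + 1 := by omega
  have h4 := h3.le
  have h5 := h3.ne'
  rcases l.lt_or_last with h | h
  · rw [stepExp_of_lt _ _ _ _ _ _ _ _ _ h]
    simp only [serveProb, afterService, freshAfter, staleClass]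
    rcases lt_trichotomy f g with hf | hf | hf
    all_goals rcases lt_trichotomy a g with ha | ha | ha
    all_goals simp [*, le_of_lt, ne_of_lt, ne_of_gt, not_le_of_gt, not_lt_of_ge,
      amcA_mulVec_c5, amcA_mulVec_c13, tick_of_lt h, last_of_lt h]
    all_goals ring
  · rw [stepExp_of_last _ _ _ _ _ _ _ _ _ h]
    simp only [serveProb, afterService, freshAfter, staleClass]
    rcases lt_trichotomy f g with hf | hf | hf
    all_goals rcases lt_trichotomy a g with ha | ha | ha
    all_goals simp [*, le_of_lt, ne_of_lt, ne_of_gt, not_le_of_gt, not_lt_of_ge,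
      amcA_mulVec_c5, amcA_mulVec_c13, tick_of_last h, last_of_last h]
    all_goals ring

set_option maxHeartbeats 1000000 in
theorem stepExp_staleClass_right (pr : Server) (D₁ : DPH N₁) (D₂ : DPH N₂) {t : ℕ} {g : ℤ}
    (hgt : g ≤ t) (u : YState N₁ N₂ k → ℝ)
    (j : Fin N₂) (b : ℤ)
    (l : Fin k) (f : ℤ) :
    stepExp pr D₁ D₂ t (fun z => (staleClass g z).elim 0 u) ⟨none, some (j, b), l, f⟩ =
      (staleClass g ⟨none, some (j, b), l, f⟩).elim 0 (amcA k pr D₁ D₂ *ᵥ u) := by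
  have h3 : g < (t : ℤ) + 1 := by omega
  have h4 := h3.le
  have h5 := h3.ne'
  rcases l.lt_or_last with h | h
  · rw [stepExp_of_lt _ _ _ _ _ _ _ _ _ h]
    simp only [serveProb, afterService, freshAfter, staleClass]
    rcases lt_trichotomy f g with hf | hf | hf
    all_goals rcases lt_trichotomy b g with hb | hb | hb
    all_goals simp [*, le_of_lt, ne_of_lt, ne_of_gt, not_le_of_gt, not_lt_of_ge,
      amcA_mulVec_c10, amcA_mulVec_c14, tick_of_lt h, last_of_lt h]
    all_goals ring
  · rw [stepExp_of_last _ _ _ _ _ _ _ _ _ h]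
    simp only [serveProb, afterService, freshAfter, staleClass]
    rcases lt_trichotomy f g with hf | hf | hf
    all_goals rcases lt_trichotomy b g with hb | hb | hb
    all_goals simp [*, le_of_lt, ne_of_lt, ne_of_gt, not_le_of_gt, not_lt_of_ge,
      amcA_mulVec_c10, amcA_mulVec_c14, tick_of_last h, last_of_last h]
    all_goals ring

set_option maxHeartbeats 1000000 in
theorem stepExp_staleClass_idle (pr : Server) (D₁ : DPH N₁) (D₂ : DPH N₂) {t : ℕ} {g : ℤ}
    (hgt : g ≤ t) (u : YState N₁ N₂ k → ℝ)
    (l : Fin k) (f : ℤ) :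
    stepExp pr D₁ D₂ t (fun z => (staleClass g z).elim 0 u) ⟨none, none, l, f⟩ =
      (staleClass g ⟨none, none, l, f⟩).elim 0 (amcA k pr D₁ D₂ *ᵥ u) := by
  have h3 : g < (t : ℤ) + 1 := by omega
  have h4 := h3.le
  have h5 := h3.ne'
  rcases l.lt_or_last with h | h
  · rw [stepExp_of_lt _ _ _ _ _ _ _ _ _ h]
    simp only [serveProb, afterService, freshAfter, staleClass]
    rcases lt_trichotomy f g with hf | hf | hf
    all_goals simp [*, le_of_lt, ne_of_lt, ne_of_gt, not_le_of_gt, not_lt_of_ge,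
      amcA_mulVec_c7, tick_of_lt h, last_of_lt h]
  · rw [stepExp_of_last _ _ _ _ _ _ _ _ _ h]
    simp only [serveProb, afterService, freshAfter, staleClass]
    rcases lt_trichotomy f g with hf | hf | hf
    all_goals simp [*, le_of_lt, ne_of_lt, ne_of_gt, not_le_of_gt, not_lt_of_ge,
      amcA_mulVec_c7, tick_of_last h, last_of_last h]

theorem stepExp_staleClass (pr : Server) (D₁ : DPH N₁) (D₂ : DPH N₂) {t : ℕ} {g : ℤ}
    (hgt : g ≤ t) (u : YState N₁ N₂ k → ℝ) (z : SysState N₁ N₂ k) :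
    stepExp pr D₁ D₂ t (fun z => (staleClass g z).elim 0 u) z =
      (staleClass g z).elim 0 (amcA k pr D₁ D₂ *ᵥ u) := by
  obtain ⟨_ | ⟨i, a⟩, _ | ⟨j, b⟩, l, f⟩ := z
  · exact stepExp_staleClass_idle pr D₁ D₂ hgt u l f
  · exact stepExp_staleClass_right pr D₁ D₂ hgt u j b l f
  · exact stepExp_staleClass_left pr D₁ D₂ hgt u i a l f
  · exact stepExp_staleClass_both pr D₁ D₂ hgt u i a j b l f

theorem staleClass_elim_one (g : ℤ) (z : SysState N₁ N₂ k) :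
    (staleClass g z).elim 0 (1 : YState N₁ N₂ k → ℝ) = if z.fresh ≤ g then 1 else 0 := by
  obtain ⟨_ | ⟨i, a⟩, _ | ⟨j, b⟩, l, f⟩ := z
  all_goals
    simp only [staleClass]
    split_ifs <;> first | (exfalso; omega) | simp

/-- The transition probabilities from the states of `W` to the initial states of `Y`. -/
def startTrans (pr : Server) (D₁ : DPH N₁) (D₂ : DPH N₂) :
    WState N₁ N₂ k → YState N₁ N₂ k → ℝ
  | .c3 j l, .c1 i' j' l' => wrap l l' * D₂.B j j' * D₁.α i'
  | .c4 i j l, .c1 i' j' l' => wrap l l' * D₁.b i * D₂.B j j' * D₁.α i'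
  | .c2 i l, .c4 i' j' l' => wrap l l' * D₁.B i i' * D₂.α j'
  | .c4 i j l, .c4 i' j' l' => wrap l l' * D₂.b j * D₁.B i i' * D₂.α j'
  | .c1 l, .c5 i' l' => prio₁ pr * wrap l l' * D₁.α i'
  | .c2 i l, .c5 i' l' => prio₁ pr * wrap l l' * D₁.b i * D₁.α i'
  | .c3 j l, .c5 i' l' => prio₁ pr * wrap l l' * D₂.b j * D₁.α i'
  | .c4 i j l, .c5 i' l' => prio₁ pr * wrap l l' * D₁.b i * D₂.b j * D₁.α i'
  | .c1 l, .c6 j' l' => prio₂ pr * wrap l l' * D₂.α j'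
  | .c2 i l, .c6 j' l' => prio₂ pr * wrap l l' * D₁.b i * D₂.α j'
  | .c3 j l, .c6 j' l' => prio₂ pr * wrap l l' * D₂.b j * D₂.α j'
  | .c4 i j l, .c6 j' l' => prio₂ pr * wrap l l' * D₁.b i * D₂.b j * D₂.α j'
  | _, _ => 0

/-- Linearity of `startWeight` in the law of `W` is what lets averages and limits pass to the age.
-/
theorem startWeight_eq_vecMul (pr : Server) (D₁ : DPH N₁) (D₂ : DPH N₂)
    (p : WState N₁ N₂ k → ℝ) :
    startWeight pr D₁ D₂ p = p ᵥ* Matrix.of (startTrans pr D₁ D₂) := by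
  have comm₁ : ∀ x : Fin k → Fin N₁ → ℝ, ∑ l, ∑ i, x l i = ∑ i, ∑ l, x l i := fun x =>
    Finset.sum_comm
  have comm₂ : ∀ x : Fin k → Fin N₂ → ℝ, ∑ l, ∑ i, x l i = ∑ i, ∑ l, x l i := fun x =>
    Finset.sum_comm
  funext s
  cases s
  all_goals
    simp only [startWeight, vecMul, dotProduct, startTrans, WState.sum_eq, of_apply, mul_zero,
      Finset.sum_const_zero, add_zero, zero_add, zero_mul, mul_add, Finset.mul_sum, Finset.sum_add_distrib,
      comm₁, comm₂, ← mul_assoc, mul_comm (p _)]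

/-- For `g = t + 1` everything present or received at slot `t` is older than `g`, so `trackClass` is
nonempty one slot later exactly if a packet is generated then. The other packet, if any, is older,
which leaves only the start states `c1`, `c4`, `c5`, `c6`. -/
theorem stepExp_trackClass_start (pr : Server) (D₁ : DPH N₁) (D₂ : DPH N₂) {t : ℕ}
    (u : YState N₁ N₂ k → ℝ) {z : SysState N₁ N₂ k} (hz : z.Admissible t) :
    stepExp pr D₁ D₂ t (fun z => (trackClass ((t : ℤ) + 1) z).elim 0 u) z =
      (Matrix.of (startTrans pr D₁ D₂) *ᵥ u) z.toW := by
  obtain ⟨hf, ha, hb, -⟩ := hz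
  obtain ⟨_ | ⟨i, a⟩, _ | ⟨j, b⟩, l, f⟩ := z
  all_goals
    simp only [Option.mem_def, Option.some.injEq, forall_eq'] at hf ha hb
    replace hf := Int.lt_add_one_of_le hf
    try replace ha := Int.lt_add_one_of_le ha
    try replace hb := Int.lt_add_one_of_le hb
    rcases l.lt_or_last with h | h
    · rw [stepExp_of_lt _ _ _ _ _ _ _ _ _ h]
      simp [serveProb, afterService, freshAfter, trackClass, SysState.toW, mulVec, dotProduct,
        startTrans, YState.sum_eq, wrap_of_lt h, *, le_of_lt, ne_of_lt, not_le_of_gt, not_lt_of_ge]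
    · rw [stepExp_of_last _ _ _ _ _ _ _ _ _ h]
      simp [serveProb, afterService, freshAfter, trackClass, SysState.toW, mulVec, dotProduct,
        startTrans, YState.sum_eq, wrap_of_last h, *, le_of_lt, ne_of_lt, not_le_of_gt,
        not_lt_of_ge]
      try ring

theorem stepExp_toW (pr : Server) (D₁ : DPH N₁) (D₂ : DPH N₂) (t : ℕ)
    (u : WState N₁ N₂ k → ℝ) (z : SysState N₁ N₂ k) :
    stepExp pr D₁ D₂ t (fun z => u z.toW) z = (rmcMatrix pr D₁ D₂ *ᵥ u) z.toW := by
  obtain ⟨_ | ⟨i, a⟩, _ | ⟨j, b⟩, l, f⟩ := z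
  all_goals
    rcases l.lt_or_last with h | h
    · rw [stepExp_of_lt _ _ _ _ _ _ _ _ _ h]
      simp [serveProb, afterService, SysState.toW, mulVec, dotProduct, rmcMatrix, rmcTrans,
        WState.sum_eq, tick_of_lt h, wrap_of_lt h, tickOrHold_of_lt h]
      try ring
    · rw [stepExp_of_last _ _ _ _ _ _ _ _ _ h]
      simp [serveProb, afterService, SysState.toW, mulVec, dotProduct, rmcMatrix, rmcTrans,
        WState.sum_eq, tick_of_last h, wrap_of_last h, tickOrHold_of_last h, add_mul,
        Finset.sum_add_distrib]
      try ring

end Lumping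

/-! ### Transience -/

section PhaseType

theorem DPH.b_eq {N : ℕ} (D : DPH N) (i : Fin N) : D.b i = 1 - ∑ j, D.B i j := by
  rw [DPH.b, sub_mulVec, one_mulVec]
  simp [mulVec, dotProduct]

theorem DPH.b_nonneg {N : ℕ} (D : DPH N) (i : Fin N) : 0 ≤ D.b i := by
  rw [D.b_eq]
  linarith [D.B_sum_le i]

theorem DPH.b_le_one {N : ℕ} (D : DPH N) (i : Fin N) : D.b i ≤ 1 := by
  rw [D.b_eq]
  linarith [Finset.sum_nonneg fun j (_ : j ∈ Finset.univ) => D.B_nonneg i j]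

theorem DPH.sum_B {N : ℕ} (D : DPH N) (i : Fin N) : ∑ j, D.B i j = 1 - D.b i := by
  rw [D.b_eq]
  ring

/-- A family indexed by the phases that is dominated by its average after one slot of service
is at most zero. -/
theorem DPH.nonpos_of_le_sum {N : ℕ} (D : DPH N) {x : Fin N → ℝ}
    (hx : ∀ i, x i ≤ ∑ i', D.B i i' * x i') (i : Fin N) : x i ≤ 0 := by
  obtain ⟨M, hM⟩ : ∃ M : ℝ, ∀ i, x i ≤ M :=
    ⟨∑ i, |x i|, fun i => (le_abs_self _).trans
      (Finset.single_le_sum (fun j _ => abs_nonneg (x j)) (Finset.mem_univ i))⟩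
  have key : ∀ n i, x i ≤ M * ((D.B ^ n) *ᵥ 1) i := by
    intro n
    induction n with
    | zero => simpa using hM
    | succ n ih =>
      intro i
      rw [pow_succ', ← mulVec_mulVec]
      refine (hx i).trans ?_
      rw [mulVec, dotProduct, Finset.mul_sum]
      refine Finset.sum_le_sum fun j _ => ?_
      rw [mul_left_comm]
      exact mul_le_mul_of_nonneg_left (ih j) (D.B_nonneg i j)
  have := (D.transient i).const_mul M
  rw [mul_zero] at this
  exact ge_of_tendsto' this fun n => key n i

/-- The maximum over the phase of the second server is dominated by its own average under `D₁.B`,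
since the rows of `D₂.B` have sum at most one. Transience of the first server therefore suffices. -/
theorem DPH.eq_zero_of_le_sum_sum {N₁ N₂ : ℕ} (D₁ : DPH N₁) (D₂ : DPH N₂)
    {x : Fin N₁ → Fin N₂ → ℝ} (hx0 : ∀ i j, 0 ≤ x i j)
    (hx : ∀ i j, x i j ≤ ∑ i', ∑ j', D₁.B i i' * D₂.B j j' * x i' j') (i : Fin N₁) (j : Fin N₂) :
    x i j = 0 := by
  have hne : (Finset.univ : Finset (Fin N₂)).Nonempty := ⟨j, Finset.mem_univ j⟩
  set X : Fin N₁ → ℝ := fun i => Finset.univ.sup' hne (x i)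
  have hX : ∀ i j, x i j ≤ X i := fun i j => Finset.le_sup' (x i) (Finset.mem_univ j)
  refine le_antisymm ((hX i j).trans (D₁.nonpos_of_le_sum (fun i => ?_) i)) (hx0 i j)
  refine Finset.sup'_le _ _ fun j' _ => (hx i j').trans (Finset.sum_le_sum fun i' _ => ?_)
  calc ∑ j'', D₁.B i i' * D₂.B j' j'' * x i' j''
      ≤ ∑ j'', D₁.B i i' * D₂.B j' j'' * X i' := Finset.sum_le_sum fun j'' _ =>
        mul_le_mul_of_nonneg_left (hX _ _) (mul_nonneg (D₁.B_nonneg _ _) (D₂.B_nonneg _ _))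
    _ = D₁.B i i' * X i' * ∑ j'', D₂.B j' j'' := by
        rw [Finset.mul_sum]
        exact Finset.sum_congr rfl fun _ _ => by ring
    _ ≤ D₁.B i i' * X i' :=
        mul_le_of_le_one_right (mul_nonneg (D₁.B_nonneg _ _) ((hx0 i' j).trans (hX i' j)))
          (D₂.B_sum_le j')

end PhaseType

/-! ### Transience of `Y` and stochasticity of `W` -/

section AbsorbingChain

variable {N₁ N₂ k : ℕ} (pr : Server) (D₁ : DPH N₁) (D₂ : DPH N₂)

theorem tick_nonneg (l l' : Fin k) : 0 ≤ tick l l' := by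
  unfold tick
  split_ifs <;> norm_num

theorem last_nonneg (l : Fin k) : 0 ≤ last l := by
  unfold last
  split_ifs <;> norm_num

theorem wrap_nonneg (l l' : Fin k) : 0 ≤ wrap l l' := by
  unfold wrap
  split_ifs
  exacts [last_nonneg l, le_rfl]

theorem tickOrHold_nonneg (l l' : Fin k) : 0 ≤ tickOrHold l l' := by
  unfold tickOrHold
  split_ifs
  exacts [last_nonneg l, tick_nonneg l l']

theorem prio₁_nonneg : 0 ≤ prio₁ pr := by
  cases pr <;> simp [prio₁]

theorem prio₂_nonneg : 0 ≤ prio₂ pr := by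
  cases pr <;> simp [prio₂]

theorem amcA_nonneg (s s' : YState N₁ N₂ k) : 0 ≤ amcA k pr D₁ D₂ s s' := by
  rw [amcA, of_apply]
  unfold amcTrans
  split <;>
  apply_rules [mul_nonneg, tick_nonneg, wrap_nonneg, last_nonneg, tickOrHold_nonneg,
    prio₁_nonneg, prio₂_nonneg, D₁.b_nonneg, D₂.b_nonneg, D₁.B_nonneg, D₂.B_nonneg,
    D₁.α_nonneg, D₂.α_nonneg, le_rfl]

theorem rmcMatrix_nonneg (w w' : WState N₁ N₂ k) : 0 ≤ rmcMatrix pr D₁ D₂ w w' := by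
  rw [rmcMatrix, of_apply]
  unfold rmcTrans
  split <;>
  apply_rules [add_nonneg, mul_nonneg, tick_nonneg, wrap_nonneg, last_nonneg, tickOrHold_nonneg,
    prio₁_nonneg, prio₂_nonneg, D₁.b_nonneg, D₂.b_nonneg, D₁.B_nonneg, D₂.B_nonneg,
    D₁.α_nonneg, D₂.α_nonneg, le_rfl]

theorem prio₂_eq : prio₂ pr = 1 - prio₁ pr := by
  cases pr <;> simp [prio₁, prio₂]

theorem amcA_mulVec_one_le (s : YState N₁ N₂ k) : (amcA k pr D₁ D₂ *ᵥ 1) s ≤ 1 := by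
  have hb : ∀ i j, 0 ≤ D₁.b i * D₂.b j ∧ D₁.b i * D₂.b j ≤ D₁.b i ∧ D₁.b i * D₂.b j ≤ D₂.b j :=
    fun i j => ⟨mul_nonneg (D₁.b_nonneg i) (D₂.b_nonneg j),
      mul_le_of_le_one_right (D₁.b_nonneg i) (D₂.b_le_one j),
      mul_le_of_le_one_left (D₂.b_nonneg j) (D₁.b_le_one i)⟩
  have h₁ := D₁.b_nonneg
  have h₂ := D₂.b_nonneg
  have h₁' := D₁.b_le_one
  have h₂' := D₂.b_le_one
  cases s with
  | c8 i j =>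
    simp only [amcA_mulVec_c8, Pi.one_apply, mul_one, ← Finset.mul_sum, ← Finset.sum_mul,
      DPH.sum_B]
    linarith [hb i j, h₁ i, h₂ j]
  | c1 i j l | c2 i j l | c3 i j l | c4 i j l | c11 i j l | c12 i j l =>
    obtain ⟨h1, h2, h3⟩ := hb i j
    rcases l.lt_or_last with h | h
    · simp only [amcA_mulVec_c1, amcA_mulVec_c2, amcA_mulVec_c3, amcA_mulVec_c4, amcA_mulVec_c11,
        amcA_mulVec_c12, Pi.one_apply, mul_one, ← Finset.mul_sum, ← Finset.sum_mul,
        DPH.sum_B, tick_of_lt h, last_of_lt h, Finset.sum_ite_eq', Finset.mem_univ, if_true]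
      linarith [h₁ i, h₂ j]
    · simp only [amcA_mulVec_c1, amcA_mulVec_c2, amcA_mulVec_c3, amcA_mulVec_c4, amcA_mulVec_c11,
        amcA_mulVec_c12, Pi.one_apply, mul_one, ← Finset.mul_sum, ← Finset.sum_mul,
        DPH.sum_B, DPH.α_sum, tick_of_last h, last_of_last h, prio₂_eq]
      linarith [h₁ i, h₂ j]
  | c5 i l | c9 i l | c13 i l =>
    rcases l.lt_or_last with h | h
    · simp only [amcA_mulVec_c5, amcA_mulVec_c9, amcA_mulVec_c13, Pi.one_apply, mul_one,
        ← Finset.mul_sum, ← Finset.sum_mul,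
        DPH.sum_B, tick_of_lt h, last_of_lt h, Finset.sum_ite_eq', Finset.mem_univ, if_true]
      linarith [h₁ i]
    · simp only [amcA_mulVec_c5, amcA_mulVec_c9, amcA_mulVec_c13, Pi.one_apply, mul_one,
        ← Finset.mul_sum, ← Finset.sum_mul,
        DPH.sum_B, DPH.α_sum, tick_of_last h, last_of_last h, prio₂_eq]
      linarith [h₁ i]
  | c6 j l | c10 j l | c14 j l =>
    rcases l.lt_or_last with h | h
    · simp only [amcA_mulVec_c6, amcA_mulVec_c10, amcA_mulVec_c14, Pi.one_apply, mul_one,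
        ← Finset.mul_sum, ← Finset.sum_mul,
        DPH.sum_B, tick_of_lt h, last_of_lt h, Finset.sum_ite_eq', Finset.mem_univ, if_true]
      linarith [h₂ j]
    · simp only [amcA_mulVec_c6, amcA_mulVec_c10, amcA_mulVec_c14, Pi.one_apply, mul_one,
        ← Finset.mul_sum, ← Finset.sum_mul,
        DPH.sum_B, DPH.α_sum, tick_of_last h, last_of_last h, prio₂_eq]
      linarith [h₂ j]
  | c7 l =>
    rcases l.lt_or_last with h | h
    · simp [amcA_mulVec_c7, tick_of_lt h, last_of_lt h]
    · simp [amcA_mulVec_c7, tick_of_last h, last_of_last h, prio₂_eq, ← Finset.mul_sum,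
        DPH.α_sum]

theorem rmcMatrix_mulVec_one : rmcMatrix (k := k) pr D₁ D₂ *ᵥ 1 = 1 := by
  funext w
  rcases w with l | ⟨i, l⟩ | ⟨j, l⟩ | ⟨i, j, l⟩ <;> rcases l.lt_or_last with h | h
  all_goals
    simp only [mulVec, dotProduct, rmcMatrix, rmcTrans, WState.sum_eq, of_apply, Pi.one_apply,
      mul_one, tick_of_lt, wrap_of_lt, tickOrHold_of_lt, tick_of_last, wrap_of_last,
      tickOrHold_of_last, h, ite_mul, zero_mul, one_mul, Finset.sum_ite_eq', Finset.mem_univ,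
      if_true, Finset.sum_add_distrib, Finset.sum_const_zero, ← Finset.mul_sum, ← Finset.sum_mul,
      DPH.sum_B, DPH.α_sum, prio₂_eq]
    try ring

theorem Fin.clock_induction {Q : Fin k → Prop} (hlast : ∀ l : Fin k, (l : ℕ) + 1 = k → Q l)
    (hstep : ∀ (l : Fin k) (h : (l : ℕ) + 1 < k), Q ⟨l + 1, h⟩ → Q l) (l : Fin k) : Q l := by
  induction hn : k - 1 - l using Nat.strong_induction_on generalizing l with
  | _ n ih =>
    rcases l.lt_or_last with h | h
    · exact hstep l h (ih _ (by rw [← hn]; simp only; omega) ⟨l + 1, h⟩ rfl)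
    · exact hlast l h

/-- Between different statuses the transitions of `Y` form no cycle, and the statuses are treated so
that successors come first. Within a status, the clock is followed backwards from `k - 1`. A status
with an idle server is left at clock `k - 1`; with both servers busy the clock is held there (`c8`
has none), and the phases leave by `DPH.eq_zero_of_le_sum_sum`. -/
theorem amcA_eq_zero_of_le_mulVec {x : YState N₁ N₂ k → ℝ} (hx0 : ∀ s, 0 ≤ x s)
    (hx : ∀ s, x s ≤ (amcA k pr D₁ D₂ *ᵥ x) s) : x = 0 := by
  have h8 : ∀ i j, x (.c8 i j) = 0 := D₁.eq_zero_of_le_sum_sum D₂ (fun _ _ => hx0 _) fun i j => by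
    simpa only [amcA_mulVec_c8] using hx (.c8 i j)
  have h13 : ∀ l i, x (.c13 i l) = 0 := by
    refine Fin.clock_induction (fun l h i => ?_) fun l h ih i => ?_ <;>
    refine le_antisymm ((hx _).trans ?_) (hx0 _)
    · simp [amcA_mulVec_c13, tick_of_last h, h8]
    · simp [amcA_mulVec_c13, tick_of_lt h, last_of_lt h, ih]
  have h14 : ∀ l j, x (.c14 j l) = 0 := by
    refine Fin.clock_induction (fun l h i => ?_) fun l h ih i => ?_ <;>
    refine le_antisymm ((hx _).trans ?_) (hx0 _)
    · simp [amcA_mulVec_c14, tick_of_last h, h8]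
    · simp [amcA_mulVec_c14, tick_of_lt h, last_of_lt h, ih]
  have h7 : ∀ l, x (.c7 l) = 0 := by
    refine Fin.clock_induction (fun l h => ?_) fun l h ih => ?_ <;>
    refine le_antisymm ((hx _).trans ?_) (hx0 _)
    · simp [amcA_mulVec_c7, tick_of_last h, h13, h14]
    · simp [amcA_mulVec_c7, tick_of_lt h, last_of_lt h, ih]
  have h12 : ∀ l i j, x (.c12 i j l) = 0 := by
    refine Fin.clock_induction (fun l h => ?_) fun l h ih i j => ?_
    · refine D₁.eq_zero_of_le_sum_sum D₂ (fun _ _ => hx0 _) fun i j => (hx _).trans ?_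
      simp [amcA_mulVec_c12, tick_of_last h, last_of_last h, h8]
    · refine le_antisymm ((hx _).trans ?_) (hx0 _)
      simp [amcA_mulVec_c12, tick_of_lt h, last_of_lt h, ih, h14]
  have h11 : ∀ l i j, x (.c11 i j l) = 0 := by
    refine Fin.clock_induction (fun l h => ?_) fun l h ih i j => ?_
    · refine D₁.eq_zero_of_le_sum_sum D₂ (fun _ _ => hx0 _) fun i j => (hx _).trans ?_
      simp [amcA_mulVec_c11, tick_of_last h, last_of_last h, h8]
    · refine le_antisymm ((hx _).trans ?_) (hx0 _)
      simp [amcA_mulVec_c11, tick_of_lt h, last_of_lt h, ih, h13]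
  have h2 : ∀ l i j, x (.c2 i j l) = 0 := by
    refine Fin.clock_induction (fun l h => ?_) fun l h ih i j => ?_
    · refine D₁.eq_zero_of_le_sum_sum D₂ (fun _ _ => hx0 _) fun i j => (hx _).trans ?_
      simp [amcA_mulVec_c2, tick_of_last h, last_of_last h, h8]
    · refine le_antisymm ((hx _).trans ?_) (hx0 _)
      simp [amcA_mulVec_c2, tick_of_lt h, last_of_lt h, ih, h14]
  have h3 : ∀ l i j, x (.c3 i j l) = 0 := by
    refine Fin.clock_induction (fun l h => ?_) fun l h ih i j => ?_
    · refine D₁.eq_zero_of_le_sum_sum D₂ (fun _ _ => hx0 _) fun i j => (hx _).trans ?_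
      simp [amcA_mulVec_c3, tick_of_last h, last_of_last h, h8]
    · refine le_antisymm ((hx _).trans ?_) (hx0 _)
      simp [amcA_mulVec_c3, tick_of_lt h, last_of_lt h, ih, h13]
  have h5 : ∀ l i, x (.c5 i l) = 0 := by
    refine Fin.clock_induction (fun l h i => ?_) fun l h ih i => ?_ <;>
    refine le_antisymm ((hx _).trans ?_) (hx0 _)
    · simp [amcA_mulVec_c5, tick_of_last h, h13, h14, h2]
    · simp [amcA_mulVec_c5, tick_of_lt h, last_of_lt h, ih, h7]
  have h6 : ∀ l j, x (.c6 j l) = 0 := by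
    refine Fin.clock_induction (fun l h i => ?_) fun l h ih i => ?_ <;>
    refine le_antisymm ((hx _).trans ?_) (hx0 _)
    · simp [amcA_mulVec_c6, tick_of_last h, h13, h14, h3]
    · simp [amcA_mulVec_c6, tick_of_lt h, last_of_lt h, ih, h7]
  have h9 : ∀ l i, x (.c9 i l) = 0 := by
    refine Fin.clock_induction (fun l h i => ?_) fun l h ih i => ?_ <;>
    refine le_antisymm ((hx _).trans ?_) (hx0 _)
    · simp [amcA_mulVec_c9, tick_of_last h, h13, h14, h12]
    · simp [amcA_mulVec_c9, tick_of_lt h, last_of_lt h, ih, h7]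
  have h10 : ∀ l j, x (.c10 j l) = 0 := by
    refine Fin.clock_induction (fun l h i => ?_) fun l h ih i => ?_ <;>
    refine le_antisymm ((hx _).trans ?_) (hx0 _)
    · simp [amcA_mulVec_c10, tick_of_last h, h13, h14, h11]
    · simp [amcA_mulVec_c10, tick_of_lt h, last_of_lt h, ih, h7]
  have h1 : ∀ l i j, x (.c1 i j l) = 0 := by
    refine Fin.clock_induction (fun l h => ?_) fun l h ih i j => ?_
    · refine D₁.eq_zero_of_le_sum_sum D₂ (fun _ _ => hx0 _) fun i j => (hx _).trans ?_
      simp [amcA_mulVec_c1, tick_of_last h, last_of_last h, h11, h13, h14, h2]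
    · refine le_antisymm ((hx _).trans ?_) (hx0 _)
      simp [amcA_mulVec_c1, tick_of_lt h, last_of_lt h, ih, h10, h7, h5]
  have h4 : ∀ l i j, x (.c4 i j l) = 0 := by
    refine Fin.clock_induction (fun l h => ?_) fun l h ih i j => ?_
    · refine D₁.eq_zero_of_le_sum_sum D₂ (fun _ _ => hx0 _) fun i j => (hx _).trans ?_
      simp [amcA_mulVec_c4, tick_of_last h, last_of_last h, h3, h13, h14, h12]
    · refine le_antisymm ((hx _).trans ?_) (hx0 _)
      simp [amcA_mulVec_c4, tick_of_lt h, last_of_lt h, ih, h6, h7, h9]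
  funext s
  cases s <;> simp [*]

end AbsorbingChain

/-! ### Nonnegative matrices -/

section NonnegMatrix

variable {S : Type*} [Fintype S] [DecidableEq S] {A : Matrix S S ℝ}

theorem Matrix.mulVec_mono_of_nonneg (hA : ∀ s s', 0 ≤ A s s') {x y : S → ℝ} (h : ∀ s, x s ≤ y s)
    (s : S) : (A *ᵥ x) s ≤ (A *ᵥ y) s :=
  Finset.sum_le_sum fun s' _ => mul_le_mul_of_nonneg_left (h s') (hA s s')

theorem Matrix.pow_nonneg_apply (hA : ∀ s s', 0 ≤ A s s') (n : ℕ) (s s' : S) :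
    0 ≤ (A ^ n) s s' := by
  induction n generalizing s s' with
  | zero =>
    rw [pow_zero, one_apply]
    split_ifs <;> norm_num
  | succ n ih =>
    rw [pow_succ, mul_apply]
    exact Finset.sum_nonneg fun r _ => mul_nonneg (ih s r) (hA r s')

/-- If `x = A x`, then `|x| ≤ A |x|` because `A` is nonnegative, so the transience hypothesis gives
`|x| = 0`. -/
theorem Matrix.isUnit_one_sub_of_transient (hA : ∀ s s', 0 ≤ A s s')
    (htr : ∀ x : S → ℝ, (∀ s, 0 ≤ x s) → (∀ s, x s ≤ (A *ᵥ x) s) → x = 0) : IsUnit (1 - A) := by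
  rw [← mulVec_injective_iff_isUnit]
  refine (injective_iff_map_eq_zero (1 - A).mulVecLin).2 fun x hx => ?_
  rw [mulVecLin_apply, sub_mulVec, one_mulVec, sub_eq_zero] at hx
  have h := htr (fun s => |x s|) (fun s => abs_nonneg _) fun s => by
    calc |x s| = |∑ s', A s s' * x s'| := by rw [congrFun hx s]; rfl
      _ ≤ ∑ s', |A s s' * x s'| := Finset.abs_sum_le_sum_abs _ _
      _ = (A *ᵥ fun s => |x s|) s :=
        Finset.sum_congr rfl fun s' _ => by rw [abs_mul, abs_of_nonneg (hA s s')]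
  exact funext fun s => abs_eq_zero.1 (congrFun h s)

/-- The vectors `A ^ n 1` decrease to a nonnegative limit fixed by `A`, which transience makes zero.
-/
theorem Matrix.tendsto_pow_mulVec_one_of_transient (hA : ∀ s s', 0 ≤ A s s')
    (hA1 : ∀ s, (A *ᵥ 1) s ≤ 1)
    (htr : ∀ x : S → ℝ, (∀ s, 0 ≤ x s) → (∀ s, x s ≤ (A *ᵥ x) s) → x = 0) (s : S) :
    Tendsto (fun n => (A ^ n *ᵥ 1) s) atTop (𝓝 0) := by
  have h0 : ∀ n s, 0 ≤ (A ^ n *ᵥ 1) s := fun n s =>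
    Finset.sum_nonneg fun s' _ => mul_nonneg (pow_nonneg_apply hA n s s') zero_le_one
  have hanti : ∀ s, Antitone fun n => (A ^ n *ᵥ 1) s := fun s => antitone_nat_of_succ_le fun n => by
    rw [pow_succ, ← mulVec_mulVec]
    exact mulVec_mono_of_nonneg (pow_nonneg_apply hA n) hA1 s
  choose x hx using fun s => (⟨_, tendsto_atTop_ciInf (hanti s) ⟨0, by
    rintro _ ⟨n, rfl⟩
    exact h0 n s⟩⟩ : ∃ x, Tendsto (fun n => (A ^ n *ᵥ 1) s) atTop (𝓝 x))
  have hfix : x = A *ᵥ x := funext fun s => by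
    refine tendsto_nhds_unique ((tendsto_add_atTop_iff_nat 1).2 (hx s)) ?_
    simp_rw [pow_succ', ← mulVec_mulVec]
    exact tendsto_finsetSum _ fun s' _ => (hx s').const_mul _
  have hx0 : x = 0 := htr x (fun s => ge_of_tendsto' (hx s) fun n => h0 n s) fun s =>
    (congrFun hfix s).le
  simpa [hx0] using hx s

theorem Matrix.tendsto_pow_of_transient (hA : ∀ s s', 0 ≤ A s s')
    (hA1 : ∀ s, (A *ᵥ 1) s ≤ 1)
    (htr : ∀ x : S → ℝ, (∀ s, 0 ≤ x s) → (∀ s, x s ≤ (A *ᵥ x) s) → x = 0) :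
    Tendsto (fun n => A ^ n) atTop (𝓝 0) := by
  refine tendsto_pi_nhds.2 fun s => tendsto_pi_nhds.2 fun s' => ?_
  refine tendsto_of_tendsto_of_tendsto_of_le_of_le tendsto_const_nhds
    (tendsto_pow_mulVec_one_of_transient hA hA1 htr s) (fun n => pow_nonneg_apply hA n s s')
    fun n => ?_
  simpa [mulVec, dotProduct] using
    Finset.single_le_sum (fun r _ => pow_nonneg_apply hA n s r) (Finset.mem_univ s')

/-- The Neumann series of a transient matrix. -/
theorem Matrix.tendsto_sum_pow_of_transient (hA : ∀ s s', 0 ≤ A s s')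
    (hA1 : ∀ s, (A *ᵥ 1) s ≤ 1)
    (htr : ∀ x : S → ℝ, (∀ s, 0 ≤ x s) → (∀ s, x s ≤ (A *ᵥ x) s) → x = 0) :
    Tendsto (fun n => ∑ m ∈ Finset.range n, A ^ m) atTop (𝓝 (1 - A)⁻¹) := by
  have hdet := (isUnit_iff_isUnit_det _).1 (isUnit_one_sub_of_transient hA htr)
  have h : ∀ n, ∑ m ∈ Finset.range n, A ^ m = (1 - A ^ n) * (1 - A)⁻¹ := fun n => by
    rw [← geom_sum_mul_neg, mul_assoc, mul_nonsing_inv _ hdet, mul_one]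
  simp_rw [h]
  simpa using ((tendsto_const_nhds (x := (1 : Matrix S S ℝ))).sub
    (tendsto_pow_of_transient hA hA1 htr)).mul_const (1 - A)⁻¹

end NonnegMatrix

/-! ### Long-run averages -/

namespace HasLongRunAverage

variable {a : ℕ → ℝ} {c : ℝ}

theorem of_tendsto (h : Tendsto a atTop (𝓝 c)) : HasLongRunAverage a c := by
  refine h.cesaro.congr fun T => ?_
  rw [div_eq_inv_mul]

theorem unique {c' : ℝ} (h : HasLongRunAverage a c) (h' : HasLongRunAverage a c') : c = c' :=
  tendsto_nhds_unique h h'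

/-- No bound on `a` is needed: the two averages differ only by `a 0 / (T + 1)` and the factor `T /
(T + 1)`. -/
theorem succ_iff : HasLongRunAverage (fun t => a (t + 1)) c ↔ HasLongRunAverage a c := by
  have hr : Tendsto (fun T : ℕ => (T : ℝ) / (T + 1)) atTop (𝓝 1) :=
    tendsto_natCast_div_add_atTop 1
  have h0 : Tendsto (fun T : ℕ => a 0 / ((T : ℝ) + 1)) atTop (𝓝 0) :=
    (tendsto_const_div_atTop_nhds_zero_nat (a 0)).comp (tendsto_add_atTop_nat 1) |>.congr
      fun T => by simp
  have key : HasLongRunAverage a c ↔ Tendsto (fun T : ℕ =>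
      (a 0 + ∑ t ∈ Finset.range T, a (t + 1)) / ((T : ℝ) + 1)) atTop (𝓝 c) := by
    rw [HasLongRunAverage, ← tendsto_add_atTop_iff_nat 1]
    refine tendsto_congr fun T => ?_
    rw [Finset.sum_range_succ', add_comm, Nat.cast_succ]
  rw [key, HasLongRunAverage]
  constructor
  · intro h
    have := h0.add (h.mul hr)
    rw [mul_one, zero_add] at this
    refine this.congr' ?_
    filter_upwards [eventually_gt_atTop 0] with T hT
    have : (T : ℝ) ≠ 0 := by positivity
    field_simp
  · intro h
    have := (h.sub h0).div hr one_ne_zero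
    rw [div_one, sub_zero] at this
    refine this.congr' ?_
    filter_upwards [eventually_gt_atTop 0] with T hT
    have : (T : ℝ) ≠ 0 := by positivity
    simp only [Pi.div_apply]
    field_simp
    ring

theorem add_iff (n : ℕ) : HasLongRunAverage (fun t => a (t + n)) c ↔ HasLongRunAverage a c := by
  induction n with
  | zero => rfl
  | succ n ih => rw [← ih, ← succ_iff (a := fun t => a (t + n))]; simp only [add_right_comm, add_assoc]

theorem sum_mul {S : Type*} [Fintype S] {b : S → ℕ → ℝ} {d : S → ℝ}
    (h : ∀ s, HasLongRunAverage (b s) (d s)) (x : S → ℝ) :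
    HasLongRunAverage (fun t => ∑ s, b s t * x s) (∑ s, d s * x s) := by
  refine (tendsto_finsetSum Finset.univ fun s _ => (h s).mul_const (x s)).congr fun T => ?_
  rw [Finset.sum_comm, Finset.sum_div]
  simp_rw [← Finset.sum_mul, div_mul_eq_mul_div]

theorem le_of_forall_le {M : ℝ} (h : HasLongRunAverage a c) (hM : ∀ t, a t ≤ M) : c ≤ M := by
  refine le_of_tendsto h ?_
  filter_upwards [eventually_gt_atTop 0] with T hT
  rw [div_le_iff₀ (by positivity)]
  calc ∑ t ∈ Finset.range T, a t ≤ ∑ t ∈ Finset.range T, M := Finset.sum_le_sum fun t _ => hM t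
    _ = M * T := by simp [mul_comm]

theorem le_of_forall_ge {M : ℝ} (h : HasLongRunAverage a c) (hM : ∀ t, M ≤ a t) : M ≤ c := by
  refine ge_of_tendsto h ?_
  filter_upwards [eventually_gt_atTop 0] with T hT
  rw [le_div_iff₀ (by positivity)]
  calc M * T = ∑ t ∈ Finset.range T, M := by simp [mul_comm]
    _ ≤ ∑ t ∈ Finset.range T, a t := Finset.sum_le_sum fun t _ => hM t

end HasLongRunAverage

/-! ### Finite stochastic matrices -/

section Stochastic

variable {S : Type*} [Fintype S] {R : Matrix S S ℝ}

theorem Matrix.sum_abs_vecMul_le (hR : ∀ s s', 0 ≤ R s s') (hR1 : R *ᵥ 1 = 1) (x : S → ℝ) :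
    ∑ s, |(x ᵥ* R) s| ≤ ∑ s, |x s| := by
  calc ∑ s', |∑ s, x s * R s s'| ≤ ∑ s', ∑ s, |x s| * R s s' :=
        Finset.sum_le_sum fun s' _ => (Finset.abs_sum_le_sum_abs _ _).trans
          (Finset.sum_le_sum fun s _ => by rw [abs_mul, abs_of_nonneg (hR s s')])
    _ = ∑ s, |x s| := by
        rw [Finset.sum_comm]
        refine Finset.sum_congr rfl fun s _ => ?_
        have : ∑ s', R s s' = 1 := by simpa [mulVec, dotProduct] using congrFun hR1 s
        rw [← Finset.mul_sum, this, mul_one]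

/-- The mean ergodic theorem for a finite stochastic matrix. -/
theorem exists_hasLongRunAverage_of_stochastic (hR : ∀ s s', 0 ≤ R s s') (hR1 : R *ᵥ 1 = 1)
    {r : ℕ → S → ℝ} (hr : ∀ t, r (t + 1) = r t ᵥ* R) :
    ∃ p : S → ℝ, ∀ s, HasLongRunAverage (fun t => r t s) (p s) := by
  set f : (S → ℝ) →ₗ[ℝ] (S → ℝ) := R.vecMulLinear
  have hf : ∀ x, f x = x ᵥ* R := fun x => rfl
  have hpow : ∀ (n : ℕ) y, ∑ s, |(f ^ n) y s| ≤ ∑ s, |y s| := by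
    intro n y
    induction n with
    | zero => rfl
    | succ n ih =>
      rw [pow_succ', Module.End.mul_apply, hf]
      exact (sum_abs_vecMul_le hR hR1 _).trans ih
  have hbound : ∀ (n : ℕ) y s, |(f ^ n) y s| ≤ ∑ s, |y s| := fun n y s =>
    (Finset.single_le_sum (fun s _ => abs_nonneg ((f ^ n) y s)) (Finset.mem_univ s)).trans
      (hpow n y)
  have hbound₀ : ∀ (y : S → ℝ) s, |y s| ≤ ∑ s, |y s| := fun y s => hbound 0 y s
  -- Here power-boundedness in the `ℓ¹` norm enters: if `x = y - f y` is fixed by `f`, then `f ^ n y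
  -- = y - n x` stays bounded, so `x = 0`. Rank and nullity then make range and kernel of `1 - f`
  -- span the space.
  have hdisj : Disjoint (LinearMap.range (1 - f)) (LinearMap.ker (1 - f)) := by
    rw [Submodule.disjoint_def]
    rintro x ⟨y, rfl⟩ hx
    set x := (1 - f) y with hxy
    have hfx : f x = x := by
      rw [LinearMap.mem_ker, LinearMap.sub_apply, Module.End.one_apply, sub_eq_zero] at hx
      exact hx.symm
    have hfy : f y = y - x := by
      rw [hxy, LinearMap.sub_apply, Module.End.one_apply, sub_sub_cancel]
    have hn : ∀ n : ℕ, (f ^ n) y = y - (n : ℝ) • x := by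
      intro n
      induction n with
      | zero => simp
      | succ n ih =>
        rw [pow_succ', Module.End.mul_apply, ih, map_sub, map_smul, hfx, hfy, Nat.cast_succ,
          add_smul, one_smul]
        abel
    funext s
    have hx0 : Tendsto (fun n : ℕ => ((f ^ n) y s - y s) / n) atTop (𝓝 0) := by
      refine squeeze_zero_norm (fun n => ?_)
        (tendsto_const_div_atTop_nhds_zero_nat (2 * ∑ s, |y s|))
      rw [norm_div, Real.norm_natCast, Real.norm_eq_abs]
      refine div_le_div_of_nonneg_right ((abs_sub _ _).trans ?_) n.cast_nonneg
      linarith [hbound n y s, hbound₀ y s]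
    have hx1 : Tendsto (fun n : ℕ => ((f ^ n) y s - y s) / n) atTop (𝓝 (-x s)) := by
      refine tendsto_const_nhds.congr' ?_
      filter_upwards [eventually_gt_atTop 0] with n hn0
      have : (n : ℝ) ≠ 0 := by positivity
      rw [hn n]
      simp only [Pi.sub_apply, Pi.smul_apply, smul_eq_mul]
      field_simp
      ring
    simpa using tendsto_nhds_unique hx1 hx0
  have htop := Submodule.eq_top_of_disjoint _ _
    (LinearMap.finrank_range_add_finrank_ker (1 - f)).ge hdisj
  obtain ⟨_, ⟨y, rfl⟩, p, hp, hsum⟩ := Submodule.mem_sup.1 (htop ▸ Submodule.mem_top (x := r 0))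
  have hfp : f p = p := by
    rw [LinearMap.mem_ker, LinearMap.sub_apply, Module.End.one_apply, sub_eq_zero] at hp
    exact hp.symm
  -- With `r 0 = p + (y - f y)` and `f p = p`, the deviations from `p` telescope and their sums stay
  -- bounded.
  have hrt : ∀ t, r t = p + ((f ^ t) y - (f ^ (t + 1)) y) := by
    intro t
    induction t with
    | zero =>
      rw [← hsum, LinearMap.sub_apply, Module.End.one_apply, pow_zero, zero_add, pow_one,
        Module.End.one_apply, add_comm]
    | succ t ih =>
      rw [hr, ← hf, ih, map_add, hfp, map_sub, ← Module.End.mul_apply, ← pow_succ',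
        ← Module.End.mul_apply, ← pow_succ']
  refine ⟨p, fun s => ?_⟩
  have hsumr : ∀ T : ℕ, ∑ t ∈ Finset.range T, r t s = T * p s + (y s - (f ^ T) y s) := by
    intro T
    induction T with
    | zero => simp
    | succ T ih =>
      rw [Finset.sum_range_succ, ih, hrt]
      simp only [Pi.add_apply, Pi.sub_apply, Nat.cast_succ]
      ring
  have h0 : Tendsto (fun T : ℕ => (y s - (f ^ T) y s) / T) atTop (𝓝 0) := by
    refine squeeze_zero_norm (fun n => ?_)
      (tendsto_const_div_atTop_nhds_zero_nat (2 * ∑ s, |y s|))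
    rw [norm_div, Real.norm_natCast, Real.norm_eq_abs]
    refine div_le_div_of_nonneg_right ((abs_sub _ _).trans ?_) n.cast_nonneg
    linarith [hbound n y s, hbound₀ y s]
  have := h0.const_add (p s)
  rw [add_zero] at this
  refine this.congr' ?_
  filter_upwards [eventually_gt_atTop 0] with T hT
  have : (T : ℝ) ≠ 0 := by positivity
  rw [hsumr]
  field_simp

theorem isStationaryLaw_of_hasLongRunAverage {r : ℕ → S → ℝ} (hr0 : ∀ t s, 0 ≤ r t s)
    (hrs : ∀ t, ∑ s, r t s = 1) (hr : ∀ t, r (t + 1) = r t ᵥ* R) {p : S → ℝ}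
    (hp : ∀ s, HasLongRunAverage (fun t => r t s) (p s)) : IsStationaryLaw R p where
  nonneg s := (hp s).le_of_forall_ge fun t => hr0 t s
  sum_eq_one := by
    have h := HasLongRunAverage.sum_mul hp 1
    simp only [Pi.one_apply, mul_one, hrs] at h
    exact h.unique (.of_tendsto tendsto_const_nhds)
  stationary := funext fun s => by
    have h := HasLongRunAverage.sum_mul hp fun s' => R s' s
    have h' : (fun t => ∑ s', r t s' * R s' s) = fun t => r (t + 1) s := funext fun t => by
      rw [hr]
      rfl
    rw [h'] at h
    exact h.unique (HasLongRunAverage.succ_iff.2 (hp s))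

/-- As `x` has total mass zero, subtracting `ε` from the column `s₀` does not change `x R`. What is
left is a nonnegative matrix with row sums `1 - ε`. -/
theorem Matrix.sum_abs_vecMul_le_of_doeblin {ε : ℝ} {s₀ : S} (hR : ∀ s s', 0 ≤ R s s')
    (hR1 : R *ᵥ 1 = 1) (hε : ∀ s, ε ≤ R s s₀) {x : S → ℝ} (hx : ∑ s, x s = 0) :
    ∑ s, |(x ᵥ* R) s| ≤ (1 - ε) * ∑ s, |x s| := by
  classical
  have h1 : ∀ s, ∑ s', R s s' = 1 := fun s => by
    simpa [mulVec, dotProduct] using congrFun hR1 s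
  have h2 : ∀ s', (x ᵥ* R) s' = ∑ s, x s * (R s s' - if s' = s₀ then ε else 0) := fun s' => by
    simp only [mul_sub, Finset.sum_sub_distrib, ← Finset.sum_mul, hx, zero_mul, sub_zero]
    rfl
  have h3 : ∀ s s', 0 ≤ R s s' - if s' = s₀ then ε else 0 := fun s s' => by
    split_ifs with h
    · rw [h]
      exact sub_nonneg.2 (hε s)
    · simpa using hR s s'
  calc ∑ s', |(x ᵥ* R) s'| ≤ ∑ s', ∑ s, |x s| * (R s s' - if s' = s₀ then ε else 0) :=
        Finset.sum_le_sum fun s' _ => by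
          rw [h2]
          exact (Finset.abs_sum_le_sum_abs _ _).trans
            (Finset.sum_le_sum fun s _ => by rw [abs_mul, abs_of_nonneg (h3 s s')])
    _ = (1 - ε) * ∑ s, |x s| := by
        rw [Finset.sum_comm]
        simp_rw [← Finset.mul_sum, Finset.sum_sub_distrib, h1]
        simp [← Finset.sum_mul, mul_comm]

/-- Convergence to a stationary law under Doeblin's condition. -/
theorem tendsto_of_doeblin [DecidableEq S] (hR : ∀ s s', 0 ≤ R s s') (hR1 : R *ᵥ 1 = 1)
    {s₀ : S} (hs₀ : ∀ s, ∀ᶠ n in atTop, 0 < (R ^ n) s s₀) {r : ℕ → S → ℝ}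
    (hrs : ∀ t, ∑ s, r t s = 1) (hr : ∀ t, r (t + 1) = r t ᵥ* R) {p : S → ℝ}
    (hp : IsStationaryLaw R p) (s : S) : Tendsto (fun t => r t s) atTop (𝓝 (p s)) := by
  -- The state space is finite, so one power has a column that is positive throughout; `ε` below is
  -- its smallest entry.
  obtain ⟨N, hN⟩ := (eventually_all.2 hs₀).exists
  have : Nonempty S := ⟨s₀⟩
  set ε := Finset.univ.inf' Finset.univ_nonempty fun s => (R ^ N) s s₀
  have hε0 : 0 < ε := (Finset.lt_inf'_iff _).2 fun s _ => hN s
  have hε : ∀ s, ε ≤ (R ^ N) s s₀ := fun s => Finset.inf'_le _ (Finset.mem_univ s)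
  have hpow : ∀ n, (∀ s s', 0 ≤ (R ^ n) s s') ∧ R ^ n *ᵥ 1 = 1 := by
    intro n
    induction n with
    | zero =>
      refine ⟨fun s s' => ?_, by simp⟩
      rw [pow_zero, one_apply]
      split_ifs <;> norm_num
    | succ n ih =>
      refine ⟨fun s s' => ?_, by rw [pow_succ, ← mulVec_mulVec, hR1, ih.2]⟩
      rw [pow_succ, mul_apply]
      exact Finset.sum_nonneg fun s'' _ => mul_nonneg (ih.1 _ _) (hR _ _)
  have hε1 : ε ≤ 1 := by
    refine (hε s₀).trans ?_
    have : ∑ s', (R ^ N) s₀ s' = 1 := by simpa [mulVec, dotProduct] using congrFun (hpow N).2 s₀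
    rw [← this]
    exact Finset.single_le_sum (fun s' _ => (hpow N).1 s₀ s') (Finset.mem_univ s₀)
  set d : ℕ → S → ℝ := fun t => r t - p
  have hd0 : ∀ t, ∑ s, d t s = 0 := fun t => by
    simp [d, Finset.sum_sub_distrib, hrs, hp.sum_eq_one]
  have hd : ∀ n t, d (t + n) = d t ᵥ* R ^ n := by
    intro n t
    induction n with
    | zero => simp
    | succ n ih =>
      rw [pow_succ, ← vecMul_vecMul, ← ih, ← add_assoc]
      simp only [d, hr, sub_vecMul, hp.stationary]
  set D : ℕ → ℝ := fun t => ∑ s, |d t s|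
  have hD0 : ∀ t, 0 ≤ D t := fun t => Finset.sum_nonneg fun _ _ => abs_nonneg _
  -- Monotonicity extends the geometric decay along multiples of `N` to all times.
  have hanti : Antitone D := antitone_nat_of_succ_le fun t => by
    simp only [D, hd 1 t, pow_one]
    exact sum_abs_vecMul_le hR hR1 _
  have hgeom : ∀ m, D (m * N) ≤ (1 - ε) ^ m * D 0 := by
    intro m
    induction m with
    | zero => simp
    | succ m ih =>
      rw [Nat.succ_mul, pow_succ', mul_assoc]
      refine le_trans ?_ (mul_le_mul_of_nonneg_left ih (by linarith))
      simp only [D, hd N]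
      exact sum_abs_vecMul_le_of_doeblin (hpow N).1 (hpow N).2 hε (hd0 _)
  obtain ⟨x, hx⟩ : ∃ x, Tendsto D atTop (𝓝 x) :=
    ⟨_, tendsto_atTop_ciInf hanti ⟨0, by rintro _ ⟨t, rfl⟩; exact hD0 t⟩⟩
  have hx0 : x ≤ 0 := by
    have hlim : Tendsto (fun m => (1 - ε) ^ m * D 0) atTop (𝓝 0) := by
      simpa using (tendsto_pow_atTop_nhds_zero_of_lt_one (by linarith) (by linarith)).mul_const (D 0)
    refine ge_of_tendsto' hlim fun m => le_trans ?_ (hgeom m)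
    exact hanti.le_of_tendsto hx _
  have hDlim : Tendsto D atTop (𝓝 0) := by
    rwa [le_antisymm hx0 (ge_of_tendsto' hx hD0)] at hx
  rw [← tendsto_sub_nhds_zero_iff]
  exact squeeze_zero_norm (fun t =>
    Finset.single_le_sum (fun s _ => abs_nonneg (d t s)) (Finset.mem_univ s)) hDlim

end Stochastic

/-! ### Laws of Markov chains on countable state spaces -/

section Discrete

variable {Ω ι : Type*} [MeasurableSpace Ω] {P : Measure Ω} [IsFiniteMeasure P] [Countable ι]

theorem hasSum_measureReal_of_partition {E : ι → Set Ω} (hE : ∀ i, MeasurableSet (E i))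
    (hd : Pairwise (Function.onFun Disjoint E)) :
    HasSum (fun i => P.real (E i)) (P.real (⋃ i, E i)) := by
  have h := ENNReal.hasSum_toReal (f := fun i => P (E i))
    (by rw [← measure_iUnion hd hE]; exact measure_ne_top _ _)
  rw [← ENNReal.tsum_toReal_eq fun _ => measure_ne_top _ _, ← measure_iUnion hd hE] at h
  exact h

end Discrete

namespace IsMarkovChain

variable {Ω S : Type*} [MeasurableSpace Ω] {P : Measure Ω} [IsProbabilityMeasure P] [Countable S]
  {Z : ℕ → Ω → S} {K : ℕ → S → S → ℝ}

theorem measurableSet_path (h : IsMarkovChain P Z K) (n : ℕ) (z : ℕ → S) :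
    MeasurableSet {ω | ∀ t ≤ n, Z t ω = z t} := by
  have : {ω | ∀ t ≤ n, Z t ω = z t} = ⋂ t ∈ Set.Iic n, Z t ⁻¹' {z t} := by
    ext ω
    simp
  rw [this]
  exact MeasurableSet.biInter (Set.to_countable _) fun t _ => h.measurableSet_preimage t _

theorem hasSum_law_indicator (h : IsMarkovChain P Z K) (t : ℕ) (E : Set S) [DecidablePred (· ∈ E)] :
    HasSum (fun z => P.real {ω | Z t ω = z} * if z ∈ E then 1 else 0)
      (P.real {ω | Z t ω ∈ E}) := by
  have h1 := hasSum_measureReal_of_partition (P := P) (E := fun z => {ω | Z t ω = z ∧ z ∈ E})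
    (fun z => (h.measurableSet_preimage t z).inter (MeasurableSet.const _))
    (fun z z' hzz' => Set.disjoint_left.2 fun ω hω hω' => hzz' (hω.1.symm.trans hω'.1))
  convert h1 using 2 with z
  · split_ifs with hz <;> simp [hz]
  · ext ω
    simp

theorem hasSum_law (h : IsMarkovChain P Z K) (t : ℕ) :
    HasSum (fun z => P.real {ω | Z t ω = z}) 1 := by
  classical
  simpa using h.hasSum_law_indicator t Set.univ

/-- `IsMarkovChain` prescribes only probabilities of whole paths. The two-slot law follows by
summing over the countably many initial segments of length `n`. -/
theorem joint_prob (h : IsMarkovChain P Z K) (n : ℕ) (z z' : S) :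
    P.real {ω | Z n ω = z ∧ Z (n + 1) ω = z'} = P.real {ω | Z n ω = z} * K n z z' := by
  -- The coordinates before `n` are free, slot `n` carries `z`, and all later slots carry `z'`; only
  -- slots up to `n + 1` are used.
  set path : (Fin n → S) → ℕ → S := fun w t =>
    if ht : t < n then w ⟨t, ht⟩ else if t = n then z else z'
  have hlt : ∀ w t (ht : t < n), path w t = w ⟨t, ht⟩ := fun w t ht => dif_pos ht
  have hn : ∀ w, path w n = z := fun w => by simp [path]
  have hn1 : ∀ w, path w (n + 1) = z' := fun w => by simp [path]
  have hdis : ∀ m, n ≤ m →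
      Pairwise (Function.onFun Disjoint fun w => {ω | ∀ t ≤ m, Z t ω = path w t}) := by
    intro m hm w w' hww'
    refine Set.disjoint_left.2 fun ω hω hω' => hww' (funext fun t => ?_)
    have h1 := hω t (t.2.le.trans hm)
    have h2 := hω' t (t.2.le.trans hm)
    rw [hlt w t t.2] at h1
    rw [hlt w' t t.2] at h2
    exact h1.symm.trans h2
  have hn0 : (⋃ w, {ω | ∀ t ≤ n, Z t ω = path w t}) = {ω | Z n ω = z} := by
    ext ω
    simp only [Set.mem_iUnion, Set.mem_ofPred_eq]
    refine ⟨fun ⟨w, hw⟩ => (hw n le_rfl).trans (hn w), fun hω => ⟨fun t : Fin n => Z (t : ℕ) ω, fun t ht => ?_⟩⟩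
    rcases ht.lt_or_eq with ht | ht
    · exact (hlt (fun t : Fin n => Z (t : ℕ) ω) t ht).symm
    · rw [ht]
      exact hω.trans (hn (fun t : Fin n => Z (t : ℕ) ω)).symm
  have hn1' : (⋃ w, {ω | ∀ t ≤ n + 1, Z t ω = path w t}) =
      {ω | Z n ω = z ∧ Z (n + 1) ω = z'} := by
    ext ω
    simp only [Set.mem_iUnion, Set.mem_ofPred_eq]
    refine ⟨fun ⟨w, hw⟩ => ⟨(hw n n.le_succ).trans (hn w), (hw (n + 1) le_rfl).trans (hn1 w)⟩,
      fun hω => ⟨fun t : Fin n => Z (t : ℕ) ω, fun t ht => ?_⟩⟩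
    rcases ht.lt_or_eq with ht | ht
    · rcases (Nat.lt_succ_iff.1 ht).lt_or_eq with ht | ht
      · exact (hlt (fun t : Fin n => Z (t : ℕ) ω) t ht).symm
      · rw [ht]
        exact hω.1.trans (hn (fun t : Fin n => Z (t : ℕ) ω)).symm
    · rw [ht]
      exact hω.2.trans (hn1 (fun t : Fin n => Z (t : ℕ) ω)).symm
  have hs := hasSum_measureReal_of_partition (P := P)
    (fun w => h.measurableSet_path n (path w)) (hdis n le_rfl)
  have hs' := hasSum_measureReal_of_partition (P := P)
    (fun w => h.measurableSet_path (n + 1) (path w)) (hdis (n + 1) n.le_succ)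
  rw [hn0] at hs
  rw [hn1'] at hs'
  have hstep : ∀ w, P.real {ω | ∀ t ≤ n + 1, Z t ω = path w t} =
      P.real {ω | ∀ t ≤ n, Z t ω = path w t} * K n z z' := fun w => by
    rw [h.path_prob, Finset.prod_range_succ, ← mul_assoc, ← h.path_prob, hn, hn1]
  simp_rw [hstep] at hs'
  exact hs'.unique (hs.mul_right (K n z z'))

/-- Expectation of `F` one slot later, where `Ff z` is the conditional expectation of `F`. -/
theorem tsum_law_succ (h : IsMarkovChain P Z K) (t : ℕ) {F G : S → ℝ} {C : ℝ}
    (hF : ∀ z, |F z| ≤ C)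
    (hG : ∀ z, P.real {ω | Z t ω = z} ≠ 0 → HasSum (fun z' => K t z z' * F z') (G z)) :
    ∑' z, P.real {ω | Z (t + 1) ω = z} * F z = ∑' z, P.real {ω | Z t ω = z} * G z := by
  have hpair := hasSum_measureReal_of_partition (P := P)
    (E := fun q : S × S => {ω | Z t ω = q.1 ∧ Z (t + 1) ω = q.2})
    (fun q => (h.measurableSet_preimage t q.1).inter (h.measurableSet_preimage (t + 1) q.2))
    (fun q q' hqq' => Set.disjoint_left.2 fun ω hω hω' =>
      hqq' (Prod.ext (hω.1.symm.trans hω'.1) (hω.2.symm.trans hω'.2)))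
  have hsum : Summable fun q : S × S =>
      P.real {ω | Z t ω = q.1 ∧ Z (t + 1) ω = q.2} * F q.2 := by
    refine Summable.of_norm_bounded (hpair.summable.mul_right C) fun q => ?_
    rw [norm_mul, Real.norm_of_nonneg measureReal_nonneg]
    exact mul_le_mul_of_nonneg_left (hF q.2) measureReal_nonneg
  have hleft : ∀ z', HasSum (fun z => P.real {ω | Z t ω = z ∧ Z (t + 1) ω = z'} * F z')
      (P.real {ω | Z (t + 1) ω = z'} * F z') := by
    intro z'
    have h1 := hasSum_measureReal_of_partition (P := P)
      (E := fun z => {ω | Z t ω = z ∧ Z (t + 1) ω = z'})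
      (fun z => (h.measurableSet_preimage t z).inter (h.measurableSet_preimage (t + 1) z'))
      (fun z z'' hzz' => Set.disjoint_left.2 fun ω hω hω' => hzz' (hω.1.symm.trans hω'.1))
    have h2 : (⋃ z, {ω | Z t ω = z ∧ Z (t + 1) ω = z'}) = {ω | Z (t + 1) ω = z'} := by
      ext ω
      simp
    rw [h2] at h1
    exact h1.mul_right (F z')
  have hright : ∀ z, HasSum (fun z' => P.real {ω | Z t ω = z ∧ Z (t + 1) ω = z'} * F z')
      (P.real {ω | Z t ω = z} * G z) := by
    intro z
    simp_rw [h.joint_prob, mul_assoc]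
    -- `hG` is required only at states of positive probability, so invariants such as `Admissible`
    -- may be used to prove it.
    by_cases hz : P.real {ω | Z t ω = z} = 0
    · simp only [hz, zero_mul]
      exact hasSum_zero
    · exact (hG z hz).mul_left _
  -- Boundedness of `F` makes the double sum absolutely summable, so it can be evaluated in either
  -- order.
  have h1 := hsum.hasSum.prod_fiberwise hright
  have h2 := ((Equiv.prodComm S S).hasSum_iff.2 hsum.hasSum).prod_fiberwise hleft
  rw [h1.tsum_eq, h2.tsum_eq]

theorem law_succ_ne_zero (h : IsMarkovChain P Z K) {t : ℕ} {z' : S}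
    (hz' : P.real {ω | Z (t + 1) ω = z'} ≠ 0) :
    ∃ z, P.real {ω | Z t ω = z} ≠ 0 ∧ K t z z' ≠ 0 := by
  by_contra! hcon
  refine hz' ?_
  have h1 := hasSum_measureReal_of_partition (P := P)
    (E := fun z => {ω | Z t ω = z ∧ Z (t + 1) ω = z'})
    (fun z => (h.measurableSet_preimage t z).inter (h.measurableSet_preimage (t + 1) z'))
    (fun z z'' hzz' => Set.disjoint_left.2 fun ω hω hω' => hzz' (hω.1.symm.trans hω'.1))
  have h2 : (⋃ z, {ω | Z t ω = z ∧ Z (t + 1) ω = z'}) = {ω | Z (t + 1) ω = z'} := by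
    ext ω
    simp
  rw [h2] at h1
  refine h1.unique ?_
  simp_rw [h.joint_prob]
  convert hasSum_zero with z
  by_cases hz : P.real {ω | Z t ω = z} = 0
  · rw [hz, zero_mul]
  · rw [hcon z hz, mul_zero]

/-- The law of a Markov chain on a finite state space. -/
theorem law_eq_pow [Fintype S] [DecidableEq S] {R : Matrix S S ℝ}
    (h : IsMarkovChain P Z fun _ => R) (n : ℕ) (s : S) :
    P.real {ω | Z n ω = s} = ((fun s => P.real {ω | Z 0 ω = s}) ᵥ* R ^ n) s := by
  induction n generalizing s with
  | zero => simp
  | succ n ih =>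
    have h1 := h.tsum_law_succ n (F := fun s' => if s' = s then 1 else 0) (G := fun z => R z s)
      (C := 1) (fun z => by split_ifs <;> simp) fun z _ => by
        convert hasSum_ite_eq s (R z s) using 2 with z'
        split_ifs with hz <;> simp [hz]
    simp only [mul_ite, mul_one, mul_zero, tsum_fintype, Finset.sum_ite_eq', Finset.mem_univ,
      if_true] at h1
    rw [h1, pow_succ, ← vecMul_vecMul]
    exact Finset.sum_congr rfl fun z _ => by rw [ih]

end IsMarkovChain

/-! ### The dual-queue system as a Markov chain -/

section System

variable {N₁ N₂ k : ℕ}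

instance : Countable (SysState N₁ N₂ k) :=
  Function.Injective.countable (f := fun z => (z.srv₁, z.srv₂, z.clock, z.fresh))
    fun z z' h => by
      simp only [Prod.mk.injEq] at h
      exact SysState.ext h.1 h.2.1 h.2.2.1 h.2.2.2

theorem hasSum_sysTrans_mul (pr : Server) (D₁ : DPH N₁) (D₂ : DPH N₂) (t : ℕ)
    (F : SysState N₁ N₂ k → ℝ) (z : SysState N₁ N₂ k) :
    HasSum (fun z' => sysTrans pr D₁ D₂ t z z' * F z') (stepExp pr D₁ D₂ t F z) := by
  simp only [sysTrans, stepExp, Finset.sum_mul]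
  refine hasSum_sum fun o₁ _ => hasSum_sum fun o₂ _ => hasSum_sum fun e₁ _ =>
    hasSum_sum fun e₂ _ => ?_
  convert hasSum_ite_eq (sysStep pr t z o₁ o₂ e₁ e₂) (serveProb D₁ z.srv₁ o₁ *
    serveProb D₂ z.srv₂ o₂ * D₁.α e₁ * D₂.α e₂ * F (sysStep pr t z o₁ o₂ e₁ e₂)) using 2 with z'
  by_cases h : sysStep pr t z o₁ o₂ e₁ e₂ = z'
  · subst h
    simp
  · rw [if_neg h, if_neg (Ne.symm h), zero_mul]

theorem exists_sysStep_of_sysTrans_ne_zero {pr : Server} {D₁ : DPH N₁} {D₂ : DPH N₂} {t : ℕ}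
    {z z' : SysState N₁ N₂ k} (h : sysTrans pr D₁ D₂ t z z' ≠ 0) :
    ∃ o₁ o₂ e₁ e₂, sysStep pr t z o₁ o₂ e₁ e₂ = z' := by
  by_contra! hcon
  exact h (by simp [sysTrans, hcon])

/-- From a state with an idle server, or after a completion, both servers can be busy only through a
packet stamped `t + 1`, newer than anything received. While both stay busy nothing is received.
Equal instants can only come from the initial state, since each slot generates at most one packet.
-/
theorem SysState.Admissible.sysStep {t : ℕ} {z : SysState N₁ N₂ k} (hz : z.Admissible t)
    (pr : Server) (o₁ : Option (Fin N₁)) (o₂ : Option (Fin N₂)) (e₁ : Fin N₁) (e₂ : Fin N₂) :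
    (sysStep pr t z o₁ o₂ e₁ e₂).Admissible ((t + 1 : ℕ) : ℤ) := by
  obtain ⟨hf, ha, hb, hab⟩ := hz
  obtain ⟨_ | ⟨i, a⟩, _ | ⟨j, b⟩, l, f⟩ := z <;> cases o₁ <;> cases o₂ <;>
  rcases l.lt_or_last with h | h <;> cases pr
  all_goals
    simp only [Option.mem_def, Option.some.injEq, forall_eq'] at hf ha hb hab
    first
    | have h' : (l : ℕ) + 1 < k := h
      simp only [_root_.sysStep, afterService, freshAfter, h', dite_true]
    | have h' : ¬ (l : ℕ) + 1 < k := h.not_lt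
      simp only [_root_.sysStep, afterService, freshAfter, h', dite_false]
    constructor <;> simp only [Option.mem_def, Option.some.injEq, forall_eq', reduceCtorEq,
      IsEmpty.forall_iff, implies_true] <;> (push_cast; omega)

end System

namespace IsDualQueue

variable {N₁ N₂ k : ℕ} {pr : Server} {D₁ : DPH N₁} {D₂ : DPH N₂} {Ω : Type*} [MeasurableSpace Ω]
  {P : Measure Ω} [IsProbabilityMeasure P] {Z : ℕ → Ω → SysState N₁ N₂ k}

theorem admissible (hZ : IsDualQueue pr D₁ D₂ P Z) {t : ℕ} {z : SysState N₁ N₂ k}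
    (hz : P.real {ω | Z t ω = z} ≠ 0) : z.Admissible t := by
  induction t generalizing z with
  | zero =>
    by_contra hcon
    refine hz ?_
    rw [measureReal_eq_zero_iff]
    refine measure_mono_null (fun ω hω => ?_) hZ.init
    rintro ⟨hf, ha, hb⟩
    have hω' : Z 0 ω = z := hω
    rw [hω'] at hf ha hb
    exact hcon ⟨hf, ha, hb, fun x hx y _ => ⟨.inl hf, fun _ => ha x hx⟩⟩
  | succ t ih =>
    obtain ⟨z₀, hz₀, hK⟩ := hZ.markov.law_succ_ne_zero hz
    obtain ⟨o₁, o₂, e₁, e₂, rfl⟩ := exists_sysStep_of_sysTrans_ne_zero hK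
    exact (ih hz₀).sysStep pr o₁ o₂ e₁ e₂

theorem tsum_succ (hZ : IsDualQueue pr D₁ D₂ P Z) (t : ℕ) {F G : SysState N₁ N₂ k → ℝ} {C : ℝ}
    (hF : ∀ z, |F z| ≤ C) (hG : ∀ z, z.Admissible t → stepExp pr D₁ D₂ t F z = G z) :
    ∑' z, P.real {ω | Z (t + 1) ω = z} * F z = ∑' z, P.real {ω | Z t ω = z} * G z :=
  hZ.markov.tsum_law_succ t hF fun z hz => by
    rw [← hG z (hZ.admissible hz)]
    exact hasSum_sysTrans_mul pr D₁ D₂ t F z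

theorem tsum_toW (hZ : IsDualQueue pr D₁ D₂ P Z) (t : ℕ) (u : WState N₁ N₂ k → ℝ) :
    ∑' z, P.real {ω | Z t ω = z} * u z.toW = ∑ w, P.real {ω | (Z t ω).toW = w} * u w := by
  have h := hasSum_sum (s := Finset.univ) fun (w : WState N₁ N₂ k) _ =>
    (hZ.markov.hasSum_law_indicator t {z | z.toW = w}).mul_right (u w)
  refine Eq.trans (tsum_congr fun z => ?_) h.tsum_eq
  simp

theorem sum_law_toW (hZ : IsDualQueue pr D₁ D₂ P Z) (t : ℕ) :
    ∑ w, P.real {ω | (Z t ω).toW = w} = 1 := by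
  have h := hZ.tsum_toW t 1
  simp only [Pi.one_apply, mul_one] at h
  rw [← h, (hZ.markov.hasSum_law t).tsum_eq]

theorem law_toW_succ (hZ : IsDualQueue pr D₁ D₂ P Z) (t : ℕ) :
    (fun w => P.real {ω | (Z (t + 1) ω).toW = w}) =
      (fun w => P.real {ω | (Z t ω).toW = w}) ᵥ* rmcMatrix pr D₁ D₂ := by
  funext w
  have h := hZ.tsum_succ t (F := fun z => (Pi.single w 1 : WState N₁ N₂ k → ℝ) z.toW) (C := 1)
    (fun z => by rw [Pi.single_apply]; split_ifs <;> simp)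
    (fun z _ => stepExp_toW pr D₁ D₂ t (Pi.single w 1) z)
  rw [hZ.tsum_toW, hZ.tsum_toW] at h
  simpa [Pi.single_apply, vecMul, dotProduct] using h

theorem abs_elim_le {S : Type*} [Fintype S] (o : Option S) (u : S → ℝ) :
    |o.elim 0 u| ≤ ∑ s, |u s| := by
  cases o with
  | none => simpa using Finset.sum_nonneg fun s _ => abs_nonneg (u s)
  | some s => exact Finset.single_le_sum (fun s _ => abs_nonneg (u s)) (Finset.mem_univ s)

/-- The central identity, exact at every time. The lumping is applied `n` times to get back from
slot `t + 1 + n` to slot `t + 1`, and the start step once to reach the law of `W` at slot `t`. -/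
theorem prob_fresh_eq (hZ : IsDualQueue pr D₁ D₂ P Z) (t n : ℕ) :
    P.real {ω | (Z (t + 1 + n) ω).fresh = (t : ℤ) + 1} =
      startWeight pr D₁ D₂ (fun w => P.real {ω | (Z t ω).toW = w}) ⬝ᵥ
        (amcA k pr D₁ D₂ ^ n *ᵥ amcV N₁ N₂ k) := by
  have hiter : ∀ (n : ℕ) (u : YState N₁ N₂ k → ℝ),
      ∑' z, P.real {ω | Z (t + 1 + n) ω = z} * (trackClass ((t : ℤ) + 1) z).elim 0 u =
        ∑' z, P.real {ω | Z (t + 1) ω = z} *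
          (trackClass ((t : ℤ) + 1) z).elim 0 (amcA k pr D₁ D₂ ^ n *ᵥ u) := by
    intro n
    induction n with
    | zero => simp
    | succ n ih =>
      intro u
      rw [pow_succ, ← mulVec_mulVec, ← ih]
      exact hZ.tsum_succ (t + 1 + n) (fun z => abs_elim_le _ u) fun z hz =>
        stepExp_trackClass pr D₁ D₂ (by omega) (by push_cast; omega) u hz
  have hsum := (hZ.markov.hasSum_law_indicator (t + 1 + n)
    {z | z.fresh = (t : ℤ) + 1}).tsum_eq
  simp only [Set.mem_ofPred_eq] at hsum
  rw [← hsum, startWeight_eq_vecMul, ← dotProduct_mulVec]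
  calc _ = ∑' z, P.real {ω | Z (t + 1 + n) ω = z} *
        (trackClass ((t : ℤ) + 1) z).elim 0 (amcV N₁ N₂ k) := by
        refine tsum_congr fun z => ?_
        by_cases hz : P.real {ω | Z (t + 1 + n) ω = z} = 0
        · rw [hz, zero_mul, zero_mul]
        · rw [trackClass_elim_amcV (by omega) (hZ.admissible hz)]
    _ = _ := by
        rw [hiter, hZ.tsum_succ t (fun z => abs_elim_le _ _) fun z hz =>
          stepExp_trackClass_start pr D₁ D₂ _ hz, hZ.tsum_toW]
        rfl

/-- The tail bound through `staleClass`. Bounding by the sum over all states of `Y` makes it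
independent of `t` and of the initial law. -/
theorem prob_fresh_le (hZ : IsDualQueue pr D₁ D₂ P Z) (t n : ℕ) :
    P.real {ω | (Z (t + n) ω).fresh ≤ t} ≤ ∑ s, |(amcA k pr D₁ D₂ ^ n *ᵥ 1) s| := by
  have hiter : ∀ (n : ℕ) (u : YState N₁ N₂ k → ℝ),
      ∑' z, P.real {ω | Z (t + n) ω = z} * (staleClass (t : ℤ) z).elim 0 u =
        ∑' z, P.real {ω | Z t ω = z} *
          (staleClass (t : ℤ) z).elim 0 (amcA k pr D₁ D₂ ^ n *ᵥ u) := by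
    intro n
    induction n with
    | zero => simp
    | succ n ih =>
      intro u
      rw [pow_succ, ← mulVec_mulVec, ← ih]
      exact hZ.tsum_succ (t + n) (fun z => abs_elim_le _ u) fun z _ =>
        stepExp_staleClass pr D₁ D₂ (by push_cast; omega) u z
  have hsum := (hZ.markov.hasSum_law_indicator (t + n) {z | z.fresh ≤ (t : ℤ)}).tsum_eq
  simp only [Set.mem_ofPred_eq, ← staleClass_elim_one] at hsum
  rw [← hsum, hiter]
  set C := ∑ s, |(amcA k pr D₁ D₂ ^ n *ᵥ 1) s|
  have hle : ∀ z, P.real {ω | Z t ω = z} *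
      (staleClass (t : ℤ) z).elim 0 (amcA k pr D₁ D₂ ^ n *ᵥ 1) ≤ P.real {ω | Z t ω = z} * C :=
    fun z => mul_le_mul_of_nonneg_left ((le_abs_self _).trans (abs_elim_le _ _))
      measureReal_nonneg
  have hC := (hZ.markov.hasSum_law t).mul_right C
  rw [one_mul] at hC
  rw [← hC.tsum_eq]
  refine Summable.tsum_le_tsum hle (Summable.of_norm_bounded hC.summable fun z => ?_) hC.summable
  rw [norm_mul, Real.norm_of_nonneg measureReal_nonneg]
  exact mul_le_mul_of_nonneg_left (abs_elim_le _ _) measureReal_nonneg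

/-- At slot `t + n` the freshest instant is at most `t + n`: either it exceeds `t`, and the age is
one of `0, …, n - 1`, or it does not. -/
theorem sum_prob_fresh (hZ : IsDualQueue pr D₁ D₂ P Z) (t n : ℕ) :
    ∑ h ∈ Finset.range n, P.real {ω | (Z (t + n) ω).fresh = (t : ℤ) + n - h} +
      P.real {ω | (Z (t + n) ω).fresh ≤ t} = 1 := by
  have h1 := hasSum_sum (s := Finset.range n) fun h _ =>
    hZ.markov.hasSum_law_indicator (t + n) {z | z.fresh = (t : ℤ) + n - h}
  have h2 := h1.add (hZ.markov.hasSum_law_indicator (t + n) {z | z.fresh ≤ (t : ℤ)})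
  refine h2.unique ?_
  convert hZ.markov.hasSum_law (t + n) using 2 with z
  by_cases hz : P.real {ω | Z (t + n) ω = z} = 0
  · simp [hz]
  have hfresh := (hZ.admissible hz).fresh_le
  push_cast at hfresh
  rw [← Finset.mul_sum, ← mul_add]
  simp only [Set.mem_ofPred_eq]
  convert mul_one _
  by_cases hle : z.fresh ≤ t
  · rw [Finset.sum_eq_zero fun h hh => if_neg (by have := Finset.mem_range.1 hh; omega), if_pos hle,
      zero_add]
  · rw [if_neg hle, add_zero, Finset.sum_eq_single ((t : ℤ) + n - z.fresh).toNat
      (fun h _ hne => if_neg (by omega))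
      (fun hnot => (hnot (Finset.mem_range.2 (by omega))).elim), if_pos (by omega)]

theorem prob_aoi_eq (hZ : IsDualQueue pr D₁ D₂ P Z) (t h : ℕ) :
    P.real {ω | aoi Z (t + (h + 1)) ω = h} =
      startWeight pr D₁ D₂ (fun w => P.real {ω | (Z t ω).toW = w}) ⬝ᵥ
        (amcA k pr D₁ D₂ ^ h *ᵥ amcV N₁ N₂ k) := by
  rw [← hZ.prob_fresh_eq t h, show t + (h + 1) = t + 1 + h by ring]
  congr 1
  ext ω
  simp only [aoi, Set.mem_ofPred_eq]
  push_cast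
  constructor <;> intro <;> omega

theorem hasLongRunAverage_aoi (hZ : IsDualQueue pr D₁ D₂ P Z) {p : WState N₁ N₂ k → ℝ}
    (hp : ∀ w, HasLongRunAverage (fun t => P.real {ω | (Z t ω).toW = w}) (p w)) (h : ℕ) :
    HasLongRunAverage (fun t => P.real {ω | aoi Z t ω = h})
      (startWeight pr D₁ D₂ p ⬝ᵥ (amcA k pr D₁ D₂ ^ h *ᵥ amcV N₁ N₂ k)) := by
  -- `prob_aoi_eq` speaks of slots from `h + 1` on; the earlier ones do not affect the average.
  rw [← HasLongRunAverage.add_iff (h + 1)]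
  simp only [hZ.prob_aoi_eq, startWeight_eq_vecMul, ← dotProduct_mulVec]
  exact HasLongRunAverage.sum_mul hp _

theorem tendsto_aoi (hZ : IsDualQueue pr D₁ D₂ P Z) {p : WState N₁ N₂ k → ℝ}
    (hp : ∀ w, Tendsto (fun t => P.real {ω | (Z t ω).toW = w}) atTop (𝓝 (p w))) (h : ℕ) :
    Tendsto (fun t => P.real {ω | aoi Z t ω = h}) atTop
      (𝓝 (startWeight pr D₁ D₂ p ⬝ᵥ (amcA k pr D₁ D₂ ^ h *ᵥ amcV N₁ N₂ k))) := by
  rw [← tendsto_add_atTop_iff_nat (h + 1)]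
  simp only [hZ.prob_aoi_eq, startWeight_eq_vecMul, ← dotProduct_mulVec]
  exact tendsto_finsetSum _ fun w _ => (hp w).mul_const _

/-- The long-run frequencies of the ages `h`, `h = 0, 1, …`, sum up to one. -/
theorem tendsto_sum_startWeight (hZ : IsDualQueue pr D₁ D₂ P Z) {p : WState N₁ N₂ k → ℝ}
    (hp : ∀ w, HasLongRunAverage (fun t => P.real {ω | (Z t ω).toW = w}) (p w)) :
    Tendsto (fun n => ∑ h ∈ Finset.range n,
      startWeight pr D₁ D₂ p ⬝ᵥ (amcA k pr D₁ D₂ ^ h *ᵥ amcV N₁ N₂ k)) atTop (𝓝 1) := by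
  have havg : ∀ n : ℕ, HasLongRunAverage
      (fun t => ∑ h ∈ Finset.range n, P.real {ω | (Z (t + n) ω).fresh = (t : ℤ) + n - h})
      (∑ h ∈ Finset.range n,
        startWeight pr D₁ D₂ p ⬝ᵥ (amcA k pr D₁ D₂ ^ h *ᵥ amcV N₁ N₂ k)) := by
    intro n
    have h1 := HasLongRunAverage.sum_mul (S := Fin n)
      (fun h => (HasLongRunAverage.add_iff n).2 (hZ.hasLongRunAverage_aoi hp h)) 1
    simp only [Pi.one_apply, mul_one] at h1
    rw [Finset.sum_range]
    convert h1 using 2 with t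
    rw [Finset.sum_range]
    refine Finset.sum_congr rfl fun h _ => ?_
    congr 1
    ext ω
    simp only [aoi, Set.mem_ofPred_eq]
    push_cast
    constructor <;> intro <;> omega
  have hε : Tendsto (fun n => 1 - ∑ s, |(amcA k pr D₁ D₂ ^ n *ᵥ 1) s|) atTop (𝓝 1) := by
    have h1 := tendsto_finsetSum Finset.univ fun s (_ : s ∈ Finset.univ) =>
      (tendsto_pow_mulVec_one_of_transient (amcA_nonneg (k := k) pr D₁ D₂)
        (amcA_mulVec_one_le pr D₁ D₂) (fun x => amcA_eq_zero_of_le_mulVec pr D₁ D₂) s).abs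
    simpa using h1.const_sub 1
  -- The `n`-th partial sum is the long-run average of the probability of an age below `n`, which
  -- lies between `1 - ∑ |A ^ n 1|` and `1` in every slot from `n` on.
  refine tendsto_of_tendsto_of_tendsto_of_le_of_le hε tendsto_const_nhds (fun n => ?_) fun n => ?_
  · refine (havg n).le_of_forall_ge fun t => ?_
    linarith [hZ.sum_prob_fresh t n, hZ.prob_fresh_le t n]
  · refine (havg n).le_of_forall_le fun t => ?_
    rw [← hZ.sum_prob_fresh t n]
    exact le_add_of_nonneg_right measureReal_nonneg

end IsDualQueue

/-! ### The age of information -/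

section Age

variable {N₁ N₂ k : ℕ} {pr : Server} {D₁ : DPH N₁} {D₂ : DPH N₂}

theorem startWeight_nonneg {p : WState N₁ N₂ k → ℝ} (hp : ∀ w, 0 ≤ p w) (s : YState N₁ N₂ k) :
    0 ≤ startWeight pr D₁ D₂ p s := by
  rw [startWeight_eq_vecMul]
  refine Finset.sum_nonneg fun w _ => mul_nonneg (hp w) ?_
  simp only [of_apply]
  unfold startTrans
  split <;>
  apply_rules [mul_nonneg, wrap_nonneg, prio₁_nonneg, prio₂_nonneg, D₁.b_nonneg, D₂.b_nonneg,
    D₁.B_nonneg, D₂.B_nonneg, D₁.α_nonneg, D₂.α_nonneg, le_rfl]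

theorem amcV_nonneg (s : YState N₁ N₂ k) : 0 ≤ amcV N₁ N₂ k s := by
  unfold amcV
  split_ifs <;> norm_num

/-- `Y` starts with `P*` still in service, so age `0` has no mass. -/
theorem startWeight_dotProduct_amcV (p : WState N₁ N₂ k → ℝ) :
    startWeight pr D₁ D₂ p ⬝ᵥ amcV N₁ N₂ k = 0 :=
  Finset.sum_eq_zero fun s _ => by cases s <;> simp [startWeight, amcV, nonPStar]

theorem amcSigma_eq_smul (p : WState N₁ N₂ k → ℝ) :
    amcSigma pr D₁ D₂ p = (∑ s, startWeight pr D₁ D₂ p s)⁻¹ • startWeight pr D₁ D₂ p := by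
  funext s
  rw [amcSigma, Pi.smul_apply, smul_eq_mul, div_eq_inv_mul]

/-- The generation rate of packets is positive, and the expected number of slots in which the
freshest received packet is `P*` is its inverse. -/
theorem startWeight_sum_pos_and_aoiNorm {p : WState N₁ N₂ k → ℝ} (hp : ∀ w, 0 ≤ p w)
    (h : Tendsto (fun n => ∑ h ∈ Finset.range n,
      startWeight pr D₁ D₂ p ⬝ᵥ (amcA k pr D₁ D₂ ^ h *ᵥ amcV N₁ N₂ k)) atTop (𝓝 1)) :
    0 < ∑ s, startWeight pr D₁ D₂ p s ∧
      aoiNorm pr D₁ D₂ p = (∑ s, startWeight pr D₁ D₂ p s)⁻¹ := by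
  set q := startWeight pr D₁ D₂ p with hq
  set A := amcA k pr D₁ D₂ with hA
  have hunit : IsUnit (1 - A) := isUnit_one_sub_of_transient (amcA_nonneg pr D₁ D₂)
    fun x => amcA_eq_zero_of_le_mulVec pr D₁ D₂
  have hdet := (isUnit_iff_isUnit_det _).1 hunit
  have hlim : Tendsto (fun n => ∑ h ∈ Finset.range n, q ⬝ᵥ (A ^ h *ᵥ amcV N₁ N₂ k)) atTop
      (𝓝 (q ⬝ᵥ ((1 - A)⁻¹ *ᵥ amcV N₁ N₂ k))) := by
    have h1 := tendsto_sum_pow_of_transient (amcA_nonneg (k := k) pr D₁ D₂)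
      (amcA_mulVec_one_le pr D₁ D₂) fun x => amcA_eq_zero_of_le_mulVec pr D₁ D₂
    have h2 : Continuous fun M : Matrix (YState N₁ N₂ k) (YState N₁ N₂ k) ℝ =>
        q ⬝ᵥ (M *ᵥ amcV N₁ N₂ k) :=
      continuous_const.dotProduct (continuous_id.matrix_mulVec continuous_const)
    refine ((h2.tendsto _).comp h1).congr fun n => ?_
    simp only [Function.comp_apply, sum_mulVec, dotProduct_sum]
    rfl
  -- This splits off the vanishing term `h = 0`, leaving `q A (I - A)⁻¹ v = 1`.
  have hinv : (1 - A)⁻¹ = 1 + A * (1 - A)⁻¹ := by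
    have h3 := mul_nonsing_inv _ hdet
    rw [sub_mul, one_mul] at h3
    exact sub_eq_iff_eq_add.1 h3
  have hone : q ⬝ᵥ ((A * (1 - A)⁻¹) *ᵥ amcV N₁ N₂ k) = 1 := by
    have h4 := tendsto_nhds_unique hlim h
    rwa [hinv, add_mulVec, one_mulVec, dotProduct_add, startWeight_dotProduct_amcV, zero_add]
      at h4
  refine ⟨(Finset.sum_nonneg fun s _ => startWeight_nonneg hp s).lt_of_ne' fun h0 => ?_, ?_⟩
  · have hq0 : q = 0 := funext fun s =>
      (Finset.sum_eq_zero_iff_of_nonneg fun s _ => startWeight_nonneg hp s).1 h0 s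
        (Finset.mem_univ s)
    rw [hq0, zero_dotProduct] at hone
    exact zero_ne_one hone
  · rw [aoiNorm, amcSigma_eq_smul, smul_vecMul, smul_dotProduct, ← dotProduct_mulVec, hone,
      smul_eq_mul, mul_one]

theorem aoiPMF_eq {p : WState N₁ N₂ k → ℝ} (hpos : 0 < ∑ s, startWeight pr D₁ D₂ p s)
    (hnorm : aoiNorm pr D₁ D₂ p = (∑ s, startWeight pr D₁ D₂ p s)⁻¹) (h : ℕ) :
    aoiPMF pr D₁ D₂ p h =
      startWeight pr D₁ D₂ p ⬝ᵥ (amcA k pr D₁ D₂ ^ h *ᵥ amcV N₁ N₂ k) := by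
  rw [aoiPMF, hnorm, amcSigma_eq_smul, smul_vecMul, smul_dotProduct, ← dotProduct_mulVec,
    smul_eq_mul, mul_div_cancel_left₀ _ (inv_ne_zero hpos.ne')]

/-- `Q` is block triangular: nothing returns from the absorbing states, so the transient part of the
law evolves by `A` alone. -/
theorem vecMul_amcQ_pow_inl (x : YState N₁ N₂ k ⊕ YAbs → ℝ) (n : ℕ) (s : YState N₁ N₂ k) :
    (x ᵥ* amcQ k pr D₁ D₂ ^ n) (.inl s) = ((x ∘ Sum.inl) ᵥ* amcA k pr D₁ D₂ ^ n) s := by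
  induction n generalizing s with
  | zero => simp
  | succ n ih =>
    rw [pow_succ, pow_succ, ← vecMul_vecMul, ← vecMul_vecMul, amcQ, vecMul_fromBlocks]
    simp only [Sum.elim_inl, vecMul_zero, add_zero]
    rw [show (x ᵥ* fromBlocks (amcA k pr D₁ D₂) (Matrix.of (amcAbsorb D₁ D₂)) 0 1 ^ n) ∘ Sum.inl =
      (x ∘ Sum.inl) ᵥ* amcA k pr D₁ D₂ ^ n from funext ih]

theorem IsAMC.prob_nonPStar {p : WState N₁ N₂ k → ℝ} {Ω : Type*} [MeasurableSpace Ω]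
    {P : Measure Ω} [IsProbabilityMeasure P] {Y : ℕ → Ω → YState N₁ N₂ k ⊕ YAbs}
    (hY : IsAMC pr D₁ D₂ p P Y) (h : ℕ) :
    P.real {ω | ∃ s ∈ nonPStar N₁ N₂ k, Y h ω = Sum.inl s} =
      amcSigma pr D₁ D₂ p ᵥ* (amcA k pr D₁ D₂ ^ h) ⬝ᵥ amcV N₁ N₂ k := by
  classical
  have hs := hY.markov.hasSum_law_indicator h (Sum.inl '' nonPStar N₁ N₂ k)
  have hset : {ω | ∃ s ∈ nonPStar N₁ N₂ k, Y h ω = Sum.inl s} =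
      {ω | Y h ω ∈ Sum.inl '' nonPStar N₁ N₂ k} := by
    ext ω
    simp [eq_comm]
  have hinit : (fun s => P.real {ω | Y 0 ω = s}) ∘ Sum.inl = amcSigma pr D₁ D₂ p :=
    funext hY.init
  have hlaw : ∀ s, P.real {ω | Y h ω = Sum.inl s} =
      (amcSigma pr D₁ D₂ p ᵥ* (amcA k pr D₁ D₂ ^ h)) s := fun s => by
    rw [hY.markov.law_eq_pow, vecMul_amcQ_pow_inl, hinit]
  rw [hset, ← hs.tsum_eq, tsum_fintype, Fintype.sum_sum_type,
    Finset.sum_eq_zero fun (s : YAbs) (_ : s ∈ Finset.univ) => by rw [if_neg (by simp), mul_zero],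
    add_zero]
  refine Finset.sum_congr rfl fun s _ => ?_
  rw [hlaw, amcV]
  simp only [Set.mem_image, Sum.inl.injEq, exists_eq_right]

end Age

theorem theorem1 {N₁ N₂ k : ℕ} (hk : 1 ≤ k) (pr : Server) (D₁ : DPH N₁) (D₂ : DPH N₂)
    {Ω : Type*} [MeasurableSpace Ω] (P : Measure Ω) [IsProbabilityMeasure P]
    (Z : ℕ → Ω → SysState N₁ N₂ k) (hZ : IsDualQueue pr D₁ D₂ P Z) :
    -- `I - A` is invertible
    IsUnit (1 - amcA k pr D₁ D₂) ∧
    -- the long-run law `p` of `W` exists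
    (∃ p : WState N₁ N₂ k → ℝ,
      ∀ w, HasLongRunAverage (fun t => P.real {ω | (Z t ω).toW = w}) (p w)) ∧
    -- if `W` is ergodic, there is a unique stationary law, and the law of `W` converges to it
    (RmcErgodic k pr D₁ D₂ →
      ∃ p : WState N₁ N₂ k → ℝ, IsStationaryLaw (rmcMatrix pr D₁ D₂) p ∧
        (∀ p', IsStationaryLaw (rmcMatrix pr D₁ D₂) p' → p' = p) ∧
        ∀ w, Tendsto (fun t => P.real {ω | (Z t ω).toW = w}) atTop (𝓝 (p w))) ∧
    ∀ p : WState N₁ N₂ k → ℝ,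
      (∀ w, HasLongRunAverage (fun t => P.real {ω | (Z t ω).toW = w}) (p w)) →
      IsStationaryLaw (rmcMatrix pr D₁ D₂) p ∧
      -- `σ` is a probability vector and the normalizing constant is positive
      (∀ s, 0 ≤ amcSigma pr D₁ D₂ p s) ∧ ∑ s, amcSigma pr D₁ D₂ p s = 1 ∧
      0 < aoiNorm pr D₁ D₂ p ∧
      -- the expression is a PMF on the positive integers
      HasSum (fun h : ℕ => aoiPMF pr D₁ D₂ p (h + 1)) 1 ∧
      -- it is the steady-state PMF of the age of information: as a long-run average, and as the
      -- limit in time whenever the law of `W` converges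
      (∀ h : ℕ, HasLongRunAverage (fun t => P.real {ω | aoi Z t ω = h}) (aoiPMF pr D₁ D₂ p h)) ∧
      ((∀ w, Tendsto (fun t => P.real {ω | (Z t ω).toW = w}) atTop (𝓝 (p w))) →
        ∀ h : ℕ, Tendsto (fun t => P.real {ω | aoi Z t ω = h}) atTop
          (𝓝 (aoiPMF pr D₁ D₂ p h))) ∧
      -- it is proportional to the probability that `Y` is in a non-`P*` state after `h` slots
      ∃ κ : ℝ, 0 < κ ∧
        ∀ {Ω' : Type*} [MeasurableSpace Ω'] (P' : Measure Ω') [IsProbabilityMeasure P']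
          (Y : ℕ → Ω' → YState N₁ N₂ k ⊕ YAbs), IsAMC pr D₁ D₂ p P' Y →
          ∀ h : ℕ, aoiPMF pr D₁ D₂ p h =
            κ * P'.real {ω | ∃ s ∈ nonPStar N₁ N₂ k, Y h ω = Sum.inl s} := by
  have hA := amcA_nonneg (k := k) pr D₁ D₂
  have htr := fun x => amcA_eq_zero_of_le_mulVec (k := k) pr D₁ D₂ (x := x)
  have hR := rmcMatrix_nonneg (k := k) pr D₁ D₂
  have hR1 := rmcMatrix_mulVec_one (k := k) pr D₁ D₂
  have hstat : ∀ p : WState N₁ N₂ k → ℝ,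
      (∀ w, HasLongRunAverage (fun t => P.real {ω | (Z t ω).toW = w}) (p w)) →
      IsStationaryLaw (rmcMatrix pr D₁ D₂) p := fun p hp =>
    isStationaryLaw_of_hasLongRunAverage (r := fun t w => P.real {ω | (Z t ω).toW = w})
      (fun _ _ => measureReal_nonneg) hZ.sum_law_toW hZ.law_toW_succ hp
  have hex := exists_hasLongRunAverage_of_stochastic hR hR1
    (r := fun t w => P.real {ω | (Z t ω).toW = w}) hZ.law_toW_succ
  refine ⟨isUnit_one_sub_of_transient hA htr, hex, ?_, fun p hp => ?_⟩
  · rintro ⟨w₀, hw₀⟩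
    obtain ⟨p, hp⟩ := hex
    have hconv := fun w => tendsto_of_doeblin hR hR1 hw₀
      (r := fun t w => P.real {ω | (Z t ω).toW = w}) hZ.sum_law_toW hZ.law_toW_succ
      (hstat p hp) w
    refine ⟨p, hstat p hp, fun p' hp' => funext fun w => ?_, hconv⟩
    -- Uniqueness: Doeblin's convergence applied to the constant sequence `p'`.
    exact tendsto_nhds_unique tendsto_const_nhds (tendsto_of_doeblin hR hR1 hw₀
      (r := fun _ => p') (fun _ => hp'.sum_eq_one) (fun _ => hp'.stationary.symm) (hstat p hp) w)
  · have hp0 := (hstat p hp).nonneg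
    have hlim := hZ.tendsto_sum_startWeight hp
    obtain ⟨hpos, hnorm⟩ := startWeight_sum_pos_and_aoiNorm hp0 hlim
    have hpmf := aoiPMF_eq hpos hnorm
    have hnorm0 : 0 < aoiNorm pr D₁ D₂ p := by
      rw [hnorm]
      exact inv_pos.2 hpos
    refine ⟨hstat p hp, fun s => div_nonneg (startWeight_nonneg hp0 s) hpos.le, ?_, hnorm0, ?_,
      fun h => ?_, fun hconv h => ?_, (aoiNorm pr D₁ D₂ p)⁻¹, inv_pos.2 hnorm0, ?_⟩
    · simp only [amcSigma, ← Finset.sum_div]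
      exact div_self hpos.ne'
    · simp_rw [← hpmf] at hlim
      have hnonneg : ∀ h, 0 ≤ aoiPMF pr D₁ D₂ p h := fun h => by
        rw [hpmf]
        exact Finset.sum_nonneg fun s _ => mul_nonneg (startWeight_nonneg hp0 s)
          (Finset.sum_nonneg fun s' _ => mul_nonneg (pow_nonneg_apply hA h s s') (amcV_nonneg s'))
      have hsum := (hasSum_iff_tendsto_nat_of_nonneg hnonneg 1).2 hlim
      -- The sum over `h ≥ 0` equals the sum over `h ≥ 1` because the value at `0` is zero.
      rw [← hasSum_nat_add_iff' 1] at hsum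
      simpa [hpmf 0, startWeight_dotProduct_amcV] using hsum
    · rw [hpmf]
      exact hZ.hasLongRunAverage_aoi hp h
    · rw [hpmf]
      exact hZ.tendsto_aoi hconv h
    · intro Ω' _ P' _ Y hY h
      rw [hY.prob_nonPStar, aoiPMF, div_eq_inv_mul]
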